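/- Let $N$ be a lattice of finite rank $r\ge 0$ and $N_{\mathbb R}=N\otimes\mathbb R$. For $S\subset N_{\mathbb R}$ let $\mathcal L(S)$ be the real span of all differences $u-v$ with $u,v\in S$, and $\mathcal L_N(S)=\mathcal L(S)\cap N$. The index of a homomorphism of lattices is the index of its image. Let $\Gamma$ be a finite connected graph with vertex set $\Gamma^{[0]}\neq\emptyset$, compact edges $\Gamma^{[1]}_c$ and non-compact edges $E_i$ ($i\in I$, each with exactly one vertex), with edge weights $w\ge 0$ and vertex genera $g(V)\ge 0$, where univalent and bivalent vertices have positive genus. Each flag $(V,E)$ carries a vector $u_{(V,E)}\in N$, which is primitive if $w(E)>0$ and $0$ if $w(E)=0$, with $u_{(V,E)}=-u_{(V',E)}$ for the two ends of a compact edge, and with $\sum_{E\ni V}w(E)u_{(V,E)}=0$ for all $V$. This data is a type $\mathfrak u$. A tropical curve $h$ of this type assigns to each $V$ a point $h(V)\in N_{\mathbb R}$ such that for each compact edge $E$ from $V$ to $V'$, $h(V')-h(V)$ is a positive multiple of $u_{(V,E)}$; the edge $E_i$ at $V$ has the image $h(V)+\mathbb R_{\ge0}u_{(V,E_i)}$.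 Put $g(\Gamma)=b_1(\Gamma)+\sum_V g(V)$ and $\mathrm{ov}(V)=\mathrm{val}(V)+3g(V)-3$. The expected dimension of the type is $d=\#I+(r-3)(1-g(\Gamma))-\sum_V\mathrm{ov}(V)$. The type is non-superabundant if it has no contracted cycles (cycles of edges of weight $0$) and no vertices of positive genus, and the space of tropical curves of this type has dimension $d$. Let $\mathbf A=(A_i)_{i\in I}$ be affine subspaces of $N_{\mathbb R}$ of rational slope and let $\Psi=(s_i)$ be non-negative integers. A curve satisfies $(\mathbf A,\Psi)$ if $h(E_i)\subset A_i$ for all $i$ and $\mathrm{ov}(V)\ge\sum_{E_i\ni V,\ w(E_i)=0}s_i$ for all $V$. A tropical curve of the given type is rigid if it satisfies $(\mathbf A,\Psi)$, is non-superabundant, $\sum_i\operatorname{codim}A_i=d$, and it is an isolated point of the space of tropical curves of its type which satisfy $(\mathbf A,\Psi)$. Let $\mathfrak D_\Gamma$ be the index of $$\Phi:\prod_{V}N\to\prod_{E\in\Gamma^{[1]}_c}N/\mathcal L_N(E)\times\prod_{i\in I}N/\mathcal L_N(A_i),\qquad H\mapsto\big((H_{\partial^+E}-H_{\partial^-E})_E,\,(H_{\partial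 E_i})_i\big),$$ and let $\mathrm{Mult}(\Gamma)=\mathfrak D_\Gamma\prod_{E\in\Gamma^{[1]}_c}w(E)$. For a compact edge $E$ of a curve of genus $0$, splitting $\Gamma$ at $E$ and extending the two half-edges to infinity gives two curves $\Gamma_1,\Gamma_2$ with new unbounded edges $E_1,E_2$. Let $W_{E_j}=\mathcal L_N(S_j)$, where $S_j$ is the union of the images of $E_j$ over all tropical curves of the type of $\Gamma_j$ which satisfy the conditions inherited from $(\mathbf A,\Psi)$, with no condition on $E_j$. Define $\mathrm{Mult}(E)$ as the index of $N/\mathbb Zu_E\to N/W_{E_1}\oplus N/W_{E_2}$, and $\mathrm{Mult}(V)$ as the index of $N\to\prod_{E\ni V}N/W_{\partial_VE,E}$, where for compact $E$, $W_{\partial_VE,E}$ is the lattice $W_{E_j}$ of the component $\Gamma_j$ that does not contain $V$, and $W_{\partial_VE_i,E_i}=\mathcal L_N(A_i)$. Then, for a type of genus $0$: (1) For generic translates $A_i$ of given rational linear subspaces (that is, for all tuples of translation vectors outside a finite union of proper affine subspaces), every non-superabundant tropical curve of this type that satisfies $(\mathbf A,\Psi)$ with $\sum_i\operatorname{codim}A_i=d$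 is rigid. (2) For every rigid tropical curve of this type, $\Phi$ and all the maps that define $\mathrm{Mult}(V)$ and $\mathrm{Mult}(E)$ are well-defined, injective and of finite index, and $$\mathfrak D_\Gamma=\frac{\prod_{V\in\Gamma^{[0]}}\mathrm{Mult}(V)}{\prod_{E\in\Gamma^{[1]}_c}\mathrm{Mult}(E)},\qquad \mathrm{Mult}(\Gamma)=\prod_{V\in\Gamma^{[0]}}\mathrm{Mult}(V)\cdot\prod_{E\in\Gamma^{[1]}_c}\frac{w(E)}{\mathrm{Mult}(E)}.$$ -/

import Mathlib

open scoped TensorProduct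

noncomputable section

namespace Tropical

universe u₁ u₂ u₃ u₄

/-! ### Lattices -/

/-- The real vector space `N_ℝ = ℝ ⊗ N` of a lattice `N`. -/
abbrev RealSpace (N : Type u₁) [AddCommGroup N] : Type u₁ := ℝ ⊗[ℤ] N

/-- The inclusion `N → N_ℝ`, `n ↦ 1 ⊗ n`. -/
def toReal (N : Type u₁) [AddCommGroup N] : N →ₗ[ℤ] RealSpace N :=
  TensorProduct.mk ℤ ℝ N 1

/-- `W ∩ N` for a linear subspace `W` of `N_ℝ`. -/
def latticePart {N : Type u₁} [AddCommGroup N] (W : Submodule ℝ (RealSpace N)) :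
    Submodule ℤ N :=
  (W.restrictScalars ℤ).comap (toReal N)

/-- `W` has rational slope: it is spanned by its lattice points. -/
def IsRational {N : Type u₁} [AddCommGroup N] (W : Submodule ℝ (RealSpace N)) : Prop :=
  Submodule.span ℝ (toReal N '' (latticePart W : Set N)) = W

/-- A nonzero lattice vector which is not a proper positive multiple of a lattice vector. -/
def IsPrimitive {N : Type u₁} [AddCommGroup N] (v : N) : Prop :=
  v ≠ 0 ∧ ∀ (k : ℕ) (v' : N), v = k • v' → k = 1

/-- The index of a homomorphism of lattices, i.e. the index of its image
(and `0` when that index is infinite). -/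
def mapIndex {A : Type u₁} {B : Type u₂} [AddCommGroup A] [AddCommGroup B]
    (f : A →ₗ[ℤ] B) : ℕ :=
  (LinearMap.range f).toAddSubgroup.index

/-! ### Types of tropical curves -/

/-- The combinatorial data of a marked weighted graph with slopes, with vertex set `V`, set of
compact edges `E`, and non-compact edges ("legs") marked by `I`.  The two ends of a compact edge
`e` are `bdry e true` and `bdry e false`, and `dir e b` is the vector `u_{(V,e)}` at
`V = bdry e b`, pointing from that end into `e`.  The leg `i` has the single vertex `leg i` and
the direction `legDir i`. -/
structure CurveType (N : Type u₁) (V : Type u₂) (E : Type u₃) (I : Type u₄) where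
  bdry : E → Bool → V
  leg : I → V
  weight : E → ℕ
  legWeight : I → ℕ
  genus : V → ℕ
  dir : E → Bool → N
  legDir : I → N

namespace CurveType

variable {N : Type u₁} {V : Type u₂} {E : Type u₃} {I : Type u₄} [AddCommGroup N]

/-- `v` and `w` are joined by a path that uses only compact edges from `S`. -/
def Reaches (T : CurveType N V E I) (S : Set E) (v w : V) : Prop :=
  Relation.ReflTransGen (fun x y => ∃ e ∈ S, ∃ b, T.bdry e b = x ∧ T.bdry e (!b) = y) v w

/-- The graph has a vertex and is connected. -/
def IsConnected (T : CurveType N V E I) : Prop :=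
  Nonempty V ∧ ∀ v w, T.Reaches Set.univ v w

/-- The valence of a vertex: the number of flags at it. -/
def val (T : CurveType N V E I) (v : V) : ℕ :=
  Nat.card {f : E × Bool // T.bdry f.1 f.2 = v} + Nat.card {i : I // T.leg i = v}

/-- The over-valence `val(v) + 3 g(v) - 3`. -/
def ov (T : CurveType N V E I) (v : V) : ℤ :=
  (T.val v : ℤ) + 3 * (T.genus v : ℤ) - 3

open Classical in
/-- The balancing condition at every vertex. -/
def IsBalanced [Fintype E] [Fintype I] (T : CurveType N V E I) : Prop :=
  ∀ v, (∑ e, ∑ b, if T.bdry e b = v then T.weight e • T.dir e b else 0)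
    + (∑ i, if T.leg i = v then T.legWeight i • T.legDir i else 0) = 0

/-- The conditions which make the data the type of a (marked, parameterized) tropical curve. -/
structure IsTropical [Fintype E] [Fintype I] (T : CurveType N V E I) : Prop where
  connected : T.IsConnected
  genus_pos : ∀ v, T.val v = 1 ∨ T.val v = 2 → 0 < T.genus v
  dir_neg : ∀ e b, T.dir e (!b) = -T.dir e b
  dir_zero : ∀ e b, T.weight e = 0 → T.dir e b = 0
  dir_primitive : ∀ e b, 0 < T.weight e → IsPrimitive (T.dir e b)
  legDir_zero : ∀ i, T.legWeight i = 0 → T.legDir i = 0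
  legDir_primitive : ∀ i, 0 < T.legWeight i → IsPrimitive (T.legDir i)
  balanced : T.IsBalanced

/-- The genus `b₁(Γ) + ∑ g(v)`, where `b₁(Γ) = #E - #V + 1` as the graph is connected. -/
def totalGenus [Fintype V] [Fintype E] (T : CurveType N V E I) : ℤ :=
  ((Fintype.card E : ℤ) - (Fintype.card V : ℤ) + 1) + ∑ v, (T.genus v : ℤ)

/-- The expected dimension `#I + (r - 3)(1 - g) - ov(Γ)`. -/
def expectedDim [Fintype V] [Fintype E] [Fintype I] (T : CurveType N V E I) : ℤ :=
  (Fintype.card I : ℤ) + ((Module.finrank ℤ N : ℤ) - 3) * (1 - T.totalGenus) - ∑ v, T.ov v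

/-! ### Tropical curves of a given type

Up to isomorphism, a tropical curve of type `T` is given by the images `h v` of the vertices. -/

/-- The tropical curves of type `T`: the vector from one end of a compact edge to the other is a
positive multiple of the direction of the edge (hence zero for an edge of weight zero). -/
def cell (T : CurveType N V E I) : Set (V → RealSpace N) :=
  {h | ∀ e, ∃ t : ℝ, 0 < t ∧
    h (T.bdry e true) - h (T.bdry e false) = t • toReal N (T.dir e false)}

/-- The image of the leg `i`: a closed ray, or a point if the leg is contracted. -/
def legImage (T : CurveType N V E I) (h : V → RealSpace N) (i : I) : Set (RealSpace N) :=
  {x | ∃ t : ℝ, 0 ≤ t ∧ x = h (T.leg i) + t • toReal N (T.legDir i)}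

open Classical in
/-- The `ψ`-class condition `(s_i)`, where only the contracted legs matter. -/
def SatisfiesPsi [Fintype I] (T : CurveType N V E I) (s : I → ℕ) : Prop :=
  ∀ v, (∑ i, if T.leg i = v ∧ T.legWeight i = 0 then (s i : ℤ) else 0) ≤ T.ov v

/-- The tropical curves of type `T` which match the affine constraint `A` and satisfy the
`ψ`-class condition `s`. -/
def moduli [Fintype I] (T : CurveType N V E I) (A : I → AffineSubspace ℝ (RealSpace N))
    (s : I → ℕ) : Set (V → RealSpace N) :=
  {h | h ∈ T.cell ∧ (∀ i, T.legImage h i ⊆ A i) ∧ T.SatisfiesPsi s}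

/-- There are no contracted cycles and no vertices of positive genus, and the space of tropical
curves of type `T` has the expected dimension. -/
def IsNonSuperabundant [Fintype V] [Fintype E] [Fintype I] (T : CurveType N V E I) : Prop :=
  (∀ e, T.weight e = 0 →
    ¬ T.Reaches {e' | T.weight e' = 0 ∧ e' ≠ e} (T.bdry e true) (T.bdry e false)) ∧
  (∀ v, T.genus v = 0) ∧
  (Module.finrank ℝ (vectorSpan ℝ T.cell) : ℤ) = T.expectedDim

/-- The codimensions of the constraints add up to the expected dimension. -/
def HasComplementaryCodim [Fintype V] [Fintype E] [Fintype I] (T : CurveType N V E I)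
    (A : I → AffineSubspace ℝ (RealSpace N)) : Prop :=
  ∑ i, (Module.finrank ℝ (RealSpace N ⧸ (A i).direction) : ℤ) = T.expectedDim

/-- `h` is an isolated point of the set `S` (for the usual topology of the finite-dimensional
space `N_ℝ`, and the product topology). -/
def IsIsolated (S : Set (V → RealSpace N)) (h : V → RealSpace N) : Prop :=
  letI : TopologicalSpace (RealSpace N) := moduleTopology ℝ (RealSpace N)
  ∃ U : Set (V → RealSpace N), IsOpen U ∧ U ∩ S = {h}

/-- The tropical curve `h` of type `T` is rigid with respect to `A` and `s`. -/
structure IsRigid [Fintype V] [Fintype E] [Fintype I] (T : CurveType N V E I)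
    (A : I → AffineSubspace ℝ (RealSpace N)) (s : I → ℕ) (h : V → RealSpace N) : Prop where
  mem : h ∈ T.moduli A s
  nonSuperabundant : T.IsNonSuperabundant
  codim : T.HasComplementaryCodim A
  isolated : IsIsolated (T.moduli A s) h

/-! ### The map `Φ` and the multiplicity -/

/-- `𝓛_N(e)`: the lattice points of the line through `0` parallel to `e`. -/
def edgeLattice (T : CurveType N V E I) (e : E) : Submodule ℤ N :=
  latticePart (Submodule.span ℝ {toReal N (T.dir e false)})

/-- The map `Φ : ∏_V N → ∏_e N/𝓛_N(e) × ∏_i N/𝓛_N(A_i)`. -/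
def Phi (T : CurveType N V E I) (A : I → AffineSubspace ℝ (RealSpace N)) :
    (V → N) →ₗ[ℤ] (∀ e, N ⧸ T.edgeLattice e) × (∀ i, N ⧸ latticePart (A i).direction) :=
  LinearMap.prod
    (LinearMap.pi fun e => (T.edgeLattice e).mkQ ∘ₗ
      ((LinearMap.proj (T.bdry e true) : (V → N) →ₗ[ℤ] N) - LinearMap.proj (T.bdry e false)))
    (LinearMap.pi fun i => (latticePart (A i).direction).mkQ ∘ₗ
      (LinearMap.proj (T.leg i) : (V → N) →ₗ[ℤ] N))

/-- `𝔇_Γ`, the index of `Φ`. -/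
def latticeMult (T : CurveType N V E I) (A : I → AffineSubspace ℝ (RealSpace N)) : ℕ :=
  mapIndex (T.Phi A)

/-- `Mult(Γ) = 𝔇_Γ ∏ w(e)`, the product over the compact edges. -/
def mult [Fintype E] (T : CurveType N V E I) (A : I → AffineSubspace ℝ (RealSpace N)) : ℕ :=
  T.latticeMult A * ∏ e, T.weight e

/-! ### Splitting a compact edge -/

/-- The vertices of the component of `Γ ∖ e` which contains the end `bdry e b` of `e`. -/
def side (T : CurveType N V E I) (e : E) (b : Bool) : Set V :=
  {v | T.Reaches {e' | e' ≠ e} (T.bdry e b) v}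

/-- The component at the end `b` of the curve split at `e`, where the half-edge of `e` at
`bdry e b` is extended to infinity and becomes the new leg `none`. -/
def split (T : CurveType N V E I) (e : E) (b : Bool) :
    CurveType N {v // v ∈ T.side e b} {e' // e' ≠ e ∧ ∀ c, T.bdry e' c ∈ T.side e b}
      (Option {i // T.leg i ∈ T.side e b}) where
  bdry e' c := ⟨T.bdry e'.1 c, e'.2.2 c⟩
  leg
    | none => ⟨T.bdry e b, Relation.ReflTransGen.refl⟩
    | some i => ⟨T.leg i.1, i.2⟩
  weight e' := T.weight e'.1
  legWeight
    | none => T.weight e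
    | some i => T.legWeight i.1
  genus v := T.genus v.1
  dir e' c := T.dir e'.1 c
  legDir
    | none => T.dir e b
    | some i => T.legDir i.1

/-- The constraints induced on a component of the split curve; none on the new leg. -/
def splitConstraint (T : CurveType N V E I) (A : I → AffineSubspace ℝ (RealSpace N))
    (e : E) (b : Bool) : Option {i // T.leg i ∈ T.side e b} → AffineSubspace ℝ (RealSpace N)
  | none => ⊤
  | some i => A i.1

/-- The `ψ`-class conditions induced on a component of the split curve; none on the new leg. -/
def splitPsi (T : CurveType N V E I) (s : I → ℕ) (e : E) (b : Bool) :
    Option {i // T.leg i ∈ T.side e b} → ℕ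
  | none => 0
  | some i => s i.1

open Classical in
/-- The set swept out by the new leg, over all tropical curves which have the type of the
component at the end `b` and satisfy the induced conditions. -/
def sweep [Fintype I] (T : CurveType N V E I) (A : I → AffineSubspace ℝ (RealSpace N))
    (s : I → ℕ) (e : E) (b : Bool) : Set (RealSpace N) :=
  ⋃ h ∈ (T.split e b).moduli (T.splitConstraint A e b) (T.splitPsi s e b),
    (T.split e b).legImage h none

/-- The lattice `W_{e_b}`: lattice points of the linear span (the span of differences) of the set
swept out by the new leg of the component at the end `b`. -/
def sweepLattice [Fintype I] (T : CurveType N V E I)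
    (A : I → AffineSubspace ℝ (RealSpace N)) (s : I → ℕ) (e : E) (b : Bool) : Submodule ℤ N :=
  latticePart (vectorSpan ℝ (T.sweep A s e b))

/-! ### Edge and vertex multiplicities -/

/-- The map `N/ℤu_e → N/W_{e_1} ⊕ N/W_{e_2}`, defined as soon as `u_e` lies in both `W`s. -/
def edgeMap [Fintype I] (T : CurveType N V E I) (A : I → AffineSubspace ℝ (RealSpace N))
    (s : I → ℕ) (e : E) (hu : ∀ b, T.dir e false ∈ T.sweepLattice A s e b) :
    (N ⧸ Submodule.span ℤ {T.dir e false}) →ₗ[ℤ]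
      (N ⧸ T.sweepLattice A s e true) × (N ⧸ T.sweepLattice A s e false) :=
  (Submodule.span ℤ {T.dir e false}).liftQ
    (LinearMap.prod (T.sweepLattice A s e true).mkQ (T.sweepLattice A s e false).mkQ)
    (by
      rw [Submodule.span_singleton_le_iff_mem, LinearMap.mem_ker]
      simp [hu])

/-- The edge multiplicity `Mult(e)`. -/
def edgeMult [Fintype I] (T : CurveType N V E I) (A : I → AffineSubspace ℝ (RealSpace N))
    (s : I → ℕ) (e : E) (hu : ∀ b, T.dir e false ∈ T.sweepLattice A s e b) : ℕ :=
  mapIndex (T.edgeMap A s e hu)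

/-- The map `N → ∏ N/W_{∂_v e, e}` over all edges `e` at the vertex `v`.  For a compact edge with
`v = bdry e b`, the lattice `W_{∂_v e, e}` comes from the component which does not contain `v`,
i.e. the one at the other end of `e`; for a leg it consists of the lattice points of the linear
space parallel to its constraint. -/
def vertexMap [Fintype I] (T : CurveType N V E I) (A : I → AffineSubspace ℝ (RealSpace N))
    (s : I → ℕ) (v : V) :
    N →ₗ[ℤ] (∀ f : {f : E × Bool // T.bdry f.1 f.2 = v},
        N ⧸ T.sweepLattice A s f.1.1 (!f.1.2)) ×
      (∀ i : {i // T.leg i = v}, N ⧸ latticePart (A i.1).direction) :=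
  LinearMap.prod
    (LinearMap.pi fun f => (T.sweepLattice A s f.1.1 (!f.1.2)).mkQ)
    (LinearMap.pi fun i => (latticePart (A i.1).direction).mkQ)

/-- The vertex multiplicity `Mult(v)`. -/
def vertexMult [Fintype I] (T : CurveType N V E I) (A : I → AffineSubspace ℝ (RealSpace N))
    (s : I → ℕ) (v : V) : ℕ :=
  mapIndex (T.vertexMap A s v)

end CurveType

end Tropical

end

/-! In genus 0 without vertex genera, #V = #E + 1, so the graph is a tree and every edge cuts it
into two sides. Being a curve of the type is an open condition inside a linear space of deformations
(`tangent`). Hence isolation means that the constrained deformation space is zero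
(`IsRigid.tangent_eq_bot`), and `W_{E_j}` consists of the lattice vectors that some deformation of
that side induces at the end of the edge, modulo the edge direction (`mem_vectorSpan_sweep`).

Part (1) is linear algebra: if a linear system whose source and target have equal dimension is
solvable for a generic right-hand side, it is surjective, hence injective.

For part (2), compare two maps from `∏_V N` to the product over all flags and legs of `N/W`, where a
flag uses the `W` of the side away from its vertex. Recording the position of the vertex at each
flag gives a block map whose index is the product of the `Mult(V)` (`prod_vertexMult_eq_index`).
Recording the edge vector at both flags of an edge gives `Φ` followed by the edge maps, of index
`𝔇_Γ ∏ Mult(E)` (`index_edgeVector`).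

The two indices agree (`change_coordinates`). At a flag the edge vector is ± the position, up to the
position of the other end. That position lies in `W` once all congruences on the far side hold,
because deformations of branches glue. So coordinates can be exchanged one by one
(`congrSubgroup_change_one`). Finiteness follows from a rank count for `Φ`, and injectivity from
gluing and the vanishing of the deformation space. -/

noncomputable section

namespace Tropical

/-! ### Indices of subgroups defined by congruences -/

section Index

theorem index_addSubgroup_pi {ι : Type*} [Fintype ι] {G : ι → Type*} [∀ i, AddCommGroup (G i)]
    (H : ∀ i, AddSubgroup (G i)) :
    (AddSubgroup.pi Set.univ H).index = ∏ i, (H i).index := by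
  simp_rw [AddSubgroup.index, ← Nat.card_pi]
  refine Nat.card_congr
    ((Quotient.congrRight (fun x y ↦ ?_)).trans (Setoid.piQuotientEquiv _).symm)
  rw [QuotientAddGroup.leftRel_pi]

/-- The index of a subgroup is determined by its image under a homomorphism and its
intersection with the kernel. -/
theorem index_eq_of_map_eq_of_inf_ker_eq {G G' : Type*} [AddCommGroup G] [AddCommGroup G']
    (f : G →+ G') {X Y : AddSubgroup G} (hmap : X.map f = Y.map f)
    (hker : X ⊓ f.ker = Y ⊓ f.ker) : X.index = Y.index := by
  -- [G : Z] = [Z + ker f : Z] · [G : Z + ker f]; the first factor depends only on Z ∩ ker f, the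
  -- second only on f(Z).
  have key : ∀ Z : AddSubgroup G, Z.index =
      (Z ⊓ f.ker).relIndex f.ker * ((Z.map f).comap f).index := by
    intro Z
    rw [AddSubgroup.comap_map_eq, AddSubgroup.inf_relIndex_right,
      ← AddSubgroup.relIndex_sup_right f.ker Z, sup_comm,
      AddSubgroup.relIndex_mul_index le_sup_left]
  rw [key X, key Y, hmap, hker]

/-- Pulling the range back along a surjection keeps its index. This moves all multiplicities from
products of different quotients of `N` to subgroups of powers of `N`, where they can be compared. -/
theorem mapIndex_eq_index {A B G : Type*} [AddCommGroup A] [AddCommGroup B] [AddCommGroup G]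
    (f : A →ₗ[ℤ] B) (π : G →+ B) (hπ : Function.Surjective π) (X : AddSubgroup G)
    (hX : ∀ x, x ∈ X ↔ ∃ a, f a = π x) : mapIndex f = X.index := by
  rw [mapIndex, ← AddSubgroup.index_comap_of_surjective _ hπ]
  congr 1
  ext x
  simp [hX]

variable {J A N : Type*} [AddCommGroup A] [AddCommGroup N]

/-- The families `x` which are congruent to `(p j a)_j` modulo `W j` for some `a`, i.e. the
preimage of the range of `a ↦ (p j a mod W j)_j`. -/
def congrSubgroup (p : J → A →ₗ[ℤ] N) (W : J → Submodule ℤ N) : AddSubgroup (J → N) where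
  carrier := {x | ∃ a, ∀ j, x j - p j a ∈ W j}
  zero_mem' := ⟨0, fun j => by simp⟩
  add_mem' := by
    rintro x y ⟨a, ha⟩ ⟨b, hb⟩
    refine ⟨a + b, fun j => ?_⟩
    have := (W j).add_mem (ha j) (hb j)
    simpa [add_sub_add_comm] using this
  neg_mem' := by
    rintro x ⟨a, ha⟩
    refine ⟨-a, fun j => ?_⟩
    have := (W j).neg_mem (ha j)
    rwa [neg_sub', ← map_neg] at this

theorem mem_congrSubgroup {p : J → A →ₗ[ℤ] N} {W : J → Submodule ℤ N} {x : J → N} :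
    x ∈ congrSubgroup p W ↔ ∃ a, ∀ j, x j - p j a ∈ W j := Iff.rfl

/-- Changing one coordinate `p j` to `q j` changes neither kernel nor index, if `q j` agrees with
`± p j` modulo `W j` on the elements at which all other coordinates vanish. -/
theorem congrSubgroup_change_one (p q : J → A →ₗ[ℤ] N) (W : J → Submodule ℤ N) (j : J)
    (hpq : ∀ k, k ≠ j → p k = q k) (ε : ℤˣ)
    (h : ∀ a, (∀ k, k ≠ j → p k a ∈ W k) → q j a - ε • p j a ∈ W j) :
    (congrSubgroup p W).index = (congrSubgroup q W).index ∧
      ∀ a, (∀ k, p k a ∈ W k) ↔ (∀ k, q k a ∈ W k) := by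
  have hu : ∀ n : N, n ∈ W j ↔ ε • n ∈ W j := fun n => by
    rcases Int.units_eq_one_or ε with rfl | rfl <;> simp
  constructor
  -- `f` forgets the coordinate `j`. The situation is symmetric in `p` and `q` because ε² = 1, so
  -- one-sided inclusions suffice.
  · let f : (J → N) →+ ({k // k ≠ j} → N) :=
      { toFun := fun x k => x k.1, map_zero' := rfl, map_add' := fun _ _ => rfl }
    have main : ∀ (p q : J → A →ₗ[ℤ] N) (hpq : ∀ k, k ≠ j → p k = q k)
        (h : ∀ a, (∀ k, k ≠ j → p k a ∈ W k) → q j a - ε • p j a ∈ W j),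
        (congrSubgroup p W).map f ≤ (congrSubgroup q W).map f ∧
        congrSubgroup p W ⊓ f.ker ≤ congrSubgroup q W ⊓ f.ker := by
      intro p q hpq h
      classical
      constructor
      · rintro _ ⟨x, ⟨a, ha⟩, rfl⟩
        -- Overwriting coordinate `j` is invisible to `f` and makes the congruence there trivial.
        refine ⟨Function.update x j (q j a), ⟨a, fun k => ?_⟩, ?_⟩
        · by_cases hk : k = j
          · subst hk; simp
          · simpa [hk, ← hpq k hk] using ha k
        · ext k
          exact Function.update_of_ne k.2 _ _
      · rintro x ⟨⟨a, ha⟩, hx⟩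
        have hx0 : ∀ k, k ≠ j → x k = 0 := fun k hk => congrFun hx ⟨k, hk⟩
        have hp : ∀ k, k ≠ j → p k a ∈ W k := fun k hk => by
          have := ha k
          rw [hx0 k hk, zero_sub] at this
          simpa using this
        -- As `x` is supported at `j`, the other coordinates of `p` vanish on `a` modulo `W`, so `q
        -- j a ≡ ε p j a`; hence `q j (ε a) ≡ p j a ≡ x j`.
        refine ⟨⟨(ε : ℤ) • a, fun k => ?_⟩, hx⟩
        by_cases hk : k = j
        · subst hk
          have h1 := h a hp
          have h2 := ha k
          rw [hu] at h1
          have : x k - q k ((ε : ℤ) • a) = (x k - p k a) - ε • (q k a - ε • p k a) := by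
            rw [smul_sub, smul_smul, Int.units_mul_self, one_smul, map_smul, ← Units.smul_def]
            abel
          rw [this]
          exact (W k).sub_mem h2 h1
        · rw [hx0 k hk, zero_sub, map_smul]
          exact (W k).neg_mem ((W k).smul_mem _ (hpq k hk ▸ hp k hk))
    have h' : ∀ a, (∀ k, k ≠ j → q k a ∈ W k) → p j a - ε • q j a ∈ W j := by
      intro a ha
      have := h a fun k hk => by rw [hpq k hk]; exact ha k hk
      rw [hu, smul_sub, smul_smul, Int.units_mul_self, one_smul] at this
      have := (W j).neg_mem this
      rwa [neg_sub] at this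
    have h1 := main p q hpq h
    have h2 := main q p (fun k hk => (hpq k hk).symm) h'
    exact index_eq_of_map_eq_of_inf_ker_eq f (le_antisymm h1.1 h2.1) (le_antisymm h1.2 h2.2)
  · intro a
    have hoff : (∀ k, k ≠ j → p k a ∈ W k) ↔ (∀ k, k ≠ j → q k a ∈ W k) :=
      forall_congr' fun k => forall_congr' fun hk => by rw [hpq k hk]
    have hsplit : ∀ r : J → A →ₗ[ℤ] N,
        (∀ k, r k a ∈ W k) ↔ (∀ k, k ≠ j → r k a ∈ W k) ∧ r j a ∈ W j := fun r =>
      ⟨fun hr => ⟨fun k _ => hr k, hr j⟩, fun hr k => by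
        by_cases hk : k = j
        · exact hk ▸ hr.2
        · exact hr.1 k hk⟩
    rw [hsplit p, hsplit q, ← hoff]
    refine and_congr_right fun hp => ?_
    rw [hu (p j a)]
    have := h a hp
    constructor
    · intro hm; simpa using (W j).add_mem this hm
    · intro hm; simpa using (W j).sub_mem hm this

-- Coordinates are exchanged one at a time, so the hypothesis is needed for every intermediate
-- family that uses `q` on `S` and `p` elsewhere.
open Classical in
theorem congrSubgroup_change_all [Finite J] (p q : J → A →ₗ[ℤ] N) (W : J → Submodule ℤ N)
    (ε : J → ℤˣ)
    (h : ∀ (S : Finset J) (j : J), j ∉ S → ∀ a,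
      (∀ k, k ≠ j → (if k ∈ S then q k else p k) a ∈ W k) → q j a - ε j • p j a ∈ W j) :
    (congrSubgroup p W).index = (congrSubgroup q W).index ∧
      ∀ a, (∀ k, p k a ∈ W k) ↔ (∀ k, q k a ∈ W k) := by
  have := Fintype.ofFinite J
  have key : ∀ S : Finset J,
      (congrSubgroup p W).index = (congrSubgroup (fun k => if k ∈ S then q k else p k) W).index ∧
      ∀ a, (∀ k, p k a ∈ W k) ↔ (∀ k, (if k ∈ S then q k else p k) a ∈ W k) := by
    intro S
    induction S using Finset.induction_on with
    | empty => simp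
    | insert j S hj ih =>
      have := congrSubgroup_change_one (fun k => if k ∈ S then q k else p k)
        (fun k => if k ∈ insert j S then q k else p k) W j
        (fun k hk => by simp [hk]) (ε j) (fun a ha => by simpa [hj] using h S j hj a ha)
      exact ⟨ih.1.trans this.1, fun a => (ih.2 a).trans (this.2 a)⟩
  simpa using key Finset.univ

/-- The index of a family of congruence conditions which is imposed blockwise. -/
theorem index_eq_prod_of_forall_mem {G κ : Type*} [AddCommGroup G] [Fintype κ] {H : κ → Type*}
    [∀ k, AddCommGroup (H k)] (ρ : ∀ k, G →+ H k)
    (hρ : ∀ y : ∀ k, H k, ∃ x, ∀ k, ρ k x = y k) (X : ∀ k, AddSubgroup (H k)) (Y : AddSubgroup G)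
    (hY : ∀ x, x ∈ Y ↔ ∀ k, ρ k x ∈ X k) : Y.index = ∏ k, (X k).index := by
  rw [← index_addSubgroup_pi, ← AddSubgroup.index_comap_of_surjective (f := AddMonoidHom.pi ρ)]
  · congr 1
    ext x
    simp [hY, AddSubgroup.mem_pi]
  · intro y
    obtain ⟨x, hx⟩ := hρ y
    exact ⟨x, funext hx⟩

end Index

end Tropical

/-! ### Trees: sides of an edge and branches at a vertex -/

namespace Tropical
namespace CurveType

variable {N V E I : Type*} {T : CurveType N V E I}

theorem Reaches.symm {S : Set E} {v w : V} (h : T.Reaches S v w) : T.Reaches S w v := by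
  induction h with
  | refl => exact Relation.ReflTransGen.refl
  | tail _ hxy ih =>
    obtain ⟨e, he, b, hx, hy⟩ := hxy
    exact Relation.ReflTransGen.head ⟨e, he, !b, hy, by simpa using hx⟩ ih

theorem bdry_mem_side (e : E) (b : Bool) : T.bdry e b ∈ T.side e b :=
  Relation.ReflTransGen.refl

theorem bdry_other_mem_side {e e' : E} {b c : Bool} (he : e' ≠ e)
    (h : T.bdry e' c ∈ T.side e b) : T.bdry e' (!c) ∈ T.side e b :=
  Relation.ReflTransGen.tail h ⟨e', he, c, rfl, rfl⟩

theorem side_induction {e : E} {b : Bool} {P : V → Prop} (h0 : P (T.bdry e b))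
    (hstep : ∀ e' c, e' ≠ e → T.bdry e' c ∈ T.side e b → P (T.bdry e' c) → P (T.bdry e' (!c)))
    {v : V} (hv : v ∈ T.side e b) : P v := by
  have : P v ∧ v ∈ T.side e b := by
    refine Relation.ReflTransGen.head_induction_on (motive := fun w _ => P w ∧ w ∈ T.side e b)
      (Reaches.symm hv) ⟨h0, bdry_mem_side e b⟩ ?_
    rintro x y ⟨e', he, c, rfl, rfl⟩ - ⟨hP, hy⟩
    have h1 := hstep e' (!c) he hy hP
    have h2 := bdry_other_mem_side he hy
    rw [Bool.not_not] at h1 h2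
    exact ⟨h1, h2⟩
  exact this.1

theorem IsConnected.induction (hT : T.IsConnected) (v₀ : V) {P : V → Prop} (h0 : P v₀)
    (hstep : ∀ e c, P (T.bdry e c) → P (T.bdry e (!c))) (v : V) : P v := by
  have := hT.2 v₀ v
  induction this with
  | refl => exact h0
  | tail _ hxy ih =>
    obtain ⟨e, -, c, rfl, rfl⟩ := hxy
    exact hstep e c ih

/-- Every edge separates the graph. -/
def EdgesSeparate (T : CurveType N V E I) : Prop :=
  ∀ e b, T.bdry e (!b) ∉ T.side e b

/-- If the ends of `e` stayed joined after deleting `e`, the remaining #E − 1 edges would connect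
all vertices, forcing #V ≤ #E. -/
theorem edgesSeparate_of_card [Fintype V] [Fintype E] (hT : T.IsConnected)
    (hcard : Fintype.card E < Fintype.card V) : T.EdgesSeparate := by
  classical
  intro e b hmem
  have := hT.1
  -- Dropping loops and merging parallel edges keeps reachability and can only lower the number of
  -- edges.
  let G : SimpleGraph V := SimpleGraph.fromRel
    fun x y => ∃ e' ≠ e, ∃ b, T.bdry e' b = x ∧ T.bdry e' (!b) = y
  have hG : ∀ e' c, e' ≠ e → G.Reachable (T.bdry e' c) (T.bdry e' (!c)) := by
    intro e' c he
    by_cases heq : T.bdry e' c = T.bdry e' (!c)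
    · rw [← heq]
    · exact SimpleGraph.Adj.reachable ⟨heq, Or.inl ⟨e', he, c, rfl, rfl⟩⟩
  have hside : ∀ v ∈ T.side e b, G.Reachable (T.bdry e b) v := fun v hv =>
    side_induction (P := fun v => G.Reachable (T.bdry e b) v) (SimpleGraph.Reachable.refl _)
      (fun e' c he _ h => h.trans (hG e' c he)) hv
  have hconn : G.Connected := by
    rw [SimpleGraph.connected_iff_exists_forall_reachable]
    refine ⟨T.bdry e b, hT.induction (T.bdry e b) (SimpleGraph.Reachable.refl _) ?_⟩
    intro e' c h
    by_cases he : e' = e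
    · subst he
      rcases Bool.eq_or_eq_not c b with rfl | rfl
      · exact hside _ hmem
      · rw [Bool.not_not]
    · exact h.trans (hG e' c he)
  have h1 := hconn.card_vert_le_card_edgeSet_add_one
  have h2 : Nat.card G.edgeSet ≤ Nat.card {e' // e' ≠ e} := by
    let f : {e' // e' ≠ e} → Sym2 V := fun e' => s(T.bdry e'.1 true, T.bdry e'.1 false)
    have hsub : G.edgeSet ⊆ Set.range f := by
      intro z
      induction z using Sym2.ind with
      | _ x y =>
        rintro ⟨-, ⟨e', he, c, rfl, rfl⟩ | ⟨e', he, c, rfl, rfl⟩⟩ <;>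
        · refine ⟨⟨e', he⟩, ?_⟩
          cases c <;> simp [f, Sym2.eq_swap]
    calc Nat.card G.edgeSet ≤ Nat.card (Set.range f) := Nat.card_mono (Set.toFinite _) hsub
      _ ≤ _ := Finite.card_range_le f
  have h3 : Fintype.card {e' // e' ≠ e} < Fintype.card E :=
    Fintype.card_subtype_lt (x := e) (by simp)
  simp only [Nat.card_eq_fintype_card] at h1 h2
  omega

theorem IsConnected.mem_side_or (hT : T.IsConnected) (e : E) (b : Bool) (v : V) :
    v ∈ T.side e b ∨ v ∈ T.side e (!b) := by
  refine hT.induction (T.bdry e b) (P := fun v => v ∈ T.side e b ∨ v ∈ T.side e (!b))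
    (Or.inl (bdry_mem_side e b)) ?_ v
  intro e' c h
  by_cases he : e' = e
  · subst he
    rcases Bool.eq_or_eq_not c b with rfl | rfl
    · exact Or.inr (bdry_mem_side _ _)
    · rw [Bool.not_not]; exact Or.inl (bdry_mem_side _ _)
  · exact h.imp (bdry_other_mem_side he) (bdry_other_mem_side he)

namespace EdgesSeparate

variable (hT : T.EdgesSeparate)
include hT

theorem not_mem_side {e : E} {b : Bool} {v : V} (h : v ∈ T.side e b) : v ∉ T.side e (!b) :=
  fun h' => hT e b (Relation.ReflTransGen.trans h (Reaches.symm h'))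

theorem edge_ne {e e' : E} {b c : Bool} (h : T.bdry e' c = T.bdry e b)
    (hne : (e', c) ≠ (e, b)) : e' ≠ e := by
  rintro rfl
  rcases Bool.eq_or_eq_not c b with rfl | rfl
  · exact hne rfl
  · exact hT e' b (h ▸ bdry_mem_side e' b)

/-- The branch at another flag of the vertex `bdry e b` is contained in `side e b`. -/
theorem branch_subset {e e' : E} {b c : Bool} (h : T.bdry e' c = T.bdry e b)
    (hne : (e', c) ≠ (e, b)) : T.side e' (!c) ⊆ T.side e b := by
  have he := hT.edge_ne h hne
  have hv : T.bdry e b ∉ T.side e' (!c) := by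
    rw [← h]; simpa using hT e' (!c)
  intro v hv'
  refine side_induction (e := e') (b := !c) (P := fun v => v ∈ T.side e b) ?_ ?_ hv'
  · exact bdry_other_mem_side he (h ▸ bdry_mem_side e b)
  · intro e'' d he'' hmem h'
    by_cases hee : e'' = e
    · subst hee
      rcases Bool.eq_or_eq_not d b with rfl | rfl
      · exact (hv hmem).elim
      · rw [Bool.not_not]; exact bdry_mem_side _ _
    · exact bdry_other_mem_side hee h'

/-- Branches at distinct flags of a vertex are disjoint: the branch at one flag lies on the near
side of the edge of the other. -/
theorem branch_unique {e e' : E} {b c : Bool} {v : V} (h : T.bdry e' c = T.bdry e b)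
    (hv : v ∈ T.side e (!b)) (hv' : v ∈ T.side e' (!c)) : (e', c) = (e, b) := by
  by_contra hne
  exact hT.not_mem_side (hT.branch_subset h hne hv') hv

end EdgesSeparate

/-- A path from `v₀` stays in the branch it has entered until it recrosses the first edge of that
branch, which returns it to `v₀`. -/
theorem IsConnected.exists_branch (hT : T.IsConnected) (v₀ v : V) :
    v = v₀ ∨ ∃ e c, T.bdry e c = v₀ ∧ v ∈ T.side e (!c) := by
  refine hT.induction v₀ (P := fun v => v = v₀ ∨ ∃ e c, T.bdry e c = v₀ ∧ v ∈ T.side e (!c))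
    (Or.inl rfl) ?_ v
  rintro e d (h | ⟨e', c, h, h'⟩)
  · exact Or.inr ⟨e, d, h, bdry_mem_side _ _⟩
  · by_cases he : e = e'
    · subst he
      rcases Bool.eq_or_eq_not d c with rfl | rfl
      · exact Or.inr ⟨e, d, h, bdry_mem_side _ _⟩
      · left; rw [Bool.not_not, h]
    · exact Or.inr ⟨e', c, h, bdry_other_mem_side he h'⟩

end CurveType
end Tropical

/-! ### Deformations of tropical curves -/

namespace Tropical
namespace CurveType

open Filter Topology

variable {N V E I : Type*} [AddCommGroup N] {T : CurveType N V E I}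

/-- The infinitesimal deformations of tropical curves of type `T` in which each leg `i` moves
within `L i`. -/
def tangent (T : CurveType N V E I) (L : I → Submodule ℝ (RealSpace N)) :
    Submodule ℝ (V → RealSpace N) where
  carrier := {c | (∀ e, c (T.bdry e true) - c (T.bdry e false) ∈
    Submodule.span ℝ {toReal N (T.dir e false)}) ∧ ∀ i, c (T.leg i) ∈ L i}
  zero_mem' := by simp
  add_mem' := by
    rintro c d ⟨hc, hc'⟩ ⟨hd, hd'⟩
    refine ⟨fun e => ?_, fun i => (L i).add_mem (hc' i) (hd' i)⟩
    have := Submodule.add_mem _ (hc e) (hd e)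
    rwa [← add_sub_add_comm] at this
  smul_mem' := by
    rintro r c ⟨hc, hc'⟩
    refine ⟨fun e => ?_, fun i => (L i).smul_mem r (hc' i)⟩
    have := Submodule.smul_mem _ r (hc e)
    rwa [smul_sub] at this

/-- A deformation changes each edge length linearly, and positivity of finitely many lengths is an
open condition. -/
theorem eventually_add_smul_mem_cell [Finite E] {h : V → RealSpace N} (hh : h ∈ T.cell)
    {c : V → RealSpace N} (hc : c ∈ T.tangent fun _ => ⊤) :
    ∀ᶠ ε in 𝓝 (0 : ℝ), h + ε • c ∈ T.cell := by
  choose t ht hht using hh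
  have hc := hc.1
  simp_rw [Submodule.mem_span_singleton] at hc
  choose a ha using hc
  have h1 : ∀ᶠ ε in 𝓝 (0 : ℝ), ∀ e, 0 < t e + ε * a e := by
    refine eventually_all.2 fun e => ?_
    have : Tendsto (fun ε : ℝ => t e + ε * a e) (𝓝 0) (𝓝 (t e + 0 * a e)) :=
      Continuous.tendsto (by fun_prop) 0
    exact this.eventually_const_lt (by simpa using ht e)
  filter_upwards [h1] with ε hε e
  refine ⟨_, hε e, ?_⟩
  simp only [Pi.add_apply, Pi.smul_apply]
  rw [add_smul, mul_smul, ← hht, ha, smul_sub]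
  abel

theorem vectorSpan_cell [Finite E] (hne : T.cell.Nonempty) :
    vectorSpan ℝ T.cell = T.tangent fun _ => ⊤ := by
  obtain ⟨h, hh⟩ := hne
  apply le_antisymm
  · rw [vectorSpan_def, Submodule.span_le]
    rintro _ ⟨x, hx, y, hy, rfl⟩
    refine ⟨fun e => ?_, fun _ => trivial⟩
    obtain ⟨t, -, ht⟩ := hx e
    obtain ⟨t', -, ht'⟩ := hy e
    rw [Submodule.mem_span_singleton]
    refine ⟨t - t', ?_⟩
    simp only [vsub_eq_sub, Pi.sub_apply]
    rw [sub_smul, ← ht, ← ht']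
    abel
  · intro c hc
    obtain ⟨ε, hε, hε0⟩ := ((eventually_nhdsWithin_of_eventually_nhds
      (eventually_add_smul_mem_cell hh hc)).and
        (self_mem_nhdsWithin (s := {(0 : ℝ)}ᶜ))).exists
    have := vsub_mem_vectorSpan ℝ hε hh
    rw [vsub_eq_sub, add_sub_cancel_left] at this
    exact (Submodule.smul_mem_iff _ hε0).1 this

theorem eventually_add_smul_mem_moduli [Finite E] [Fintype I]
    {A : I → AffineSubspace ℝ (RealSpace N)} {s : I → ℕ} {h : V → RealSpace N}
    (hh : h ∈ T.moduli A s) {c : V → RealSpace N}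
    (hc : c ∈ T.tangent fun i => (A i).direction) :
    ∀ᶠ ε in 𝓝 (0 : ℝ), h + ε • c ∈ T.moduli A s := by
  filter_upwards [eventually_add_smul_mem_cell hh.1 (c := c) ⟨hc.1, fun _ => trivial⟩] with ε hε
  refine ⟨hε, fun i => ?_, hh.2.2⟩
  rintro x ⟨t, ht, rfl⟩
  have h1 : h (T.leg i) + t • toReal N (T.legDir i) ∈ A i := hh.2.1 i ⟨t, ht, rfl⟩
  have h2 := AffineSubspace.vadd_mem_of_mem_direction
    ((A i).direction.smul_mem ε (hc.2 i)) h1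
  have h3 : (h + ε • c) (T.leg i) + t • toReal N (T.legDir i) =
      ε • c (T.leg i) +ᵥ (h (T.leg i) + t • toReal N (T.legDir i)) := by
    simp only [Pi.add_apply, Pi.smul_apply, vadd_eq_add]
    abel
  rw [h3]
  exact h2

theorem apply_leg_mem_of_mem_moduli [Fintype I]
    {A : I → AffineSubspace ℝ (RealSpace N)} {s : I → ℕ} {h : V → RealSpace N}
    (hh : h ∈ T.moduli A s) (i : I) : h (T.leg i) ∈ A i :=
  hh.2.1 i ⟨0, le_rfl, by simp⟩

theorem sub_mem_tangent_of_mem_moduli [Finite E] [Fintype I]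
    {A : I → AffineSubspace ℝ (RealSpace N)} {s : I → ℕ} {h h' : V → RealSpace N}
    (hh : h ∈ T.moduli A s) (hh' : h' ∈ T.moduli A s) :
    h - h' ∈ T.tangent fun i => (A i).direction := by
  have h1 : h - h' ∈ T.tangent fun _ => ⊤ := by
    rw [← vectorSpan_cell ⟨h, hh.1⟩]
    exact vsub_mem_vectorSpan ℝ hh.1 hh'.1
  exact ⟨h1.1, fun i => AffineSubspace.vsub_mem_direction
    (apply_leg_mem_of_mem_moduli hh i) (apply_leg_mem_of_mem_moduli hh' i)⟩

/-- A nonzero constrained deformation would give a segment of curves through `h` that satisfy the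
conditions. All later uses of isolation go through this linear statement. -/
theorem IsRigid.tangent_eq_bot [Fintype V] [Fintype E] [Fintype I]
    {A : I → AffineSubspace ℝ (RealSpace N)} {s : I → ℕ} {h : V → RealSpace N}
    (hh : T.IsRigid A s h) : T.tangent (fun i => (A i).direction) = ⊥ := by
  rw [eq_bot_iff]
  intro c hc
  let _ : TopologicalSpace (RealSpace N) := moduleTopology ℝ (RealSpace N)
  have : IsModuleTopology ℝ (RealSpace N) := ⟨rfl⟩
  have : ContinuousAdd (RealSpace N) := IsModuleTopology.toContinuousAdd ℝ _
  have : ContinuousSMul ℝ (RealSpace N) := IsModuleTopology.toContinuousSMul ℝ _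
  obtain ⟨U, hU, hUh⟩ := hh.isolated
  have hcont : Continuous fun ε : ℝ => h + ε • c := by fun_prop
  have hmem : h ∈ U := by
    have : h ∈ U ∩ T.moduli A s := hUh ▸ rfl
    exact this.1
  have h1 : ∀ᶠ ε in 𝓝 (0 : ℝ), h + ε • c ∈ U :=
    hcont.continuousAt.eventually_mem (hU.mem_nhds (by simpa using hmem))
  obtain ⟨ε, ⟨hε, hε'⟩, hε0⟩ := ((eventually_nhdsWithin_of_eventually_nhds
    (h1.and (eventually_add_smul_mem_moduli hh.mem hc))).and
      (self_mem_nhdsWithin (s := {(0 : ℝ)}ᶜ))).exists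
  have h2 : h + ε • c ∈ U ∩ T.moduli A s := ⟨hε, hε'⟩
  rw [hUh, Set.mem_singleton_iff] at h2
  exact (smul_eq_zero.1 (_root_.add_eq_left.1 h2)).resolve_left hε0

theorem isIsolated_of_subsingleton {S : Set (V → RealSpace N)} (hS : S.Subsingleton)
    {h : V → RealSpace N} (hh : h ∈ S) : IsIsolated S h :=
  ⟨Set.univ, @isOpen_univ _ (_), by
    rw [Set.univ_inter]; exact hS.eq_singleton_of_mem hh⟩

/-! ### Splitting at an edge -/

-- No flag is lost by splitting, since the cut half-edge survives as the new leg. The ψ-condition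
-- bounds the over-valence from below, so it passes to the components.
omit [AddCommGroup N] in
theorem EdgesSeparate.val_le_val_split [Finite E] [Finite I] (hT : T.EdgesSeparate) (e : E)
    (b : Bool) (v : {v // v ∈ T.side e b}) : T.val v.1 ≤ (T.split e b).val v := by
  classical
  unfold val
  -- Since `e` separates, only its end `b` lies on this side, so a single flag becomes the new leg.
  have hc : ∀ f : {f : E × Bool // T.bdry f.1 f.2 = v.1}, f.1.1 = e → f.1.2 = b := by
    rintro ⟨⟨e', c⟩, hf⟩ (rfl : e' = e)
    rcases Bool.eq_or_eq_not c b with h | rfl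
    · exact h
    · exact (hT e' b (hf ▸ v.2)).elim
  have hm : ∀ f : {f : E × Bool // T.bdry f.1 f.2 = v.1}, f.1.1 ≠ e →
      f.1.1 ≠ e ∧ ∀ c, T.bdry f.1.1 c ∈ T.side e b := by
    rintro ⟨⟨e', c⟩, hf⟩ he
    refine ⟨he, fun d => ?_⟩
    have h1 : T.bdry e' c ∈ T.side e b := hf ▸ v.2
    rcases Bool.eq_or_eq_not d c with rfl | rfl
    · exact h1
    · exact bdry_other_mem_side he h1
  rw [← Nat.card_sum, ← Nat.card_sum]
  let F : {f : E × Bool // T.bdry f.1 f.2 = v.1} ⊕ {i : I // T.leg i = v.1} →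
      {f : {e' // e' ≠ e ∧ ∀ c, T.bdry e' c ∈ T.side e b} × Bool //
        (T.split e b).bdry f.1 f.2 = v} ⊕
      {i : Option {i // T.leg i ∈ T.side e b} // (T.split e b).leg i = v} :=
    Sum.elim
      (fun f => if he : f.1.1 = e then Sum.inr ⟨none, Subtype.ext (by
          change T.bdry e b = v.1
          rw [← f.2, hc f he, he])⟩
        else Sum.inl ⟨⟨⟨f.1.1, hm f he⟩, f.1.2⟩, Subtype.ext f.2⟩)
      (fun i => Sum.inr ⟨some ⟨i.1, by rw [i.2]; exact v.2⟩, Subtype.ext i.2⟩)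
  refine Nat.card_le_card_of_injective F ?_
  rintro (f | i) (g | j) hfg
  · by_cases h1 : f.1.1 = e <;> by_cases h2 : g.1.1 = e
    · rw [Sum.inl.injEq, Subtype.ext_iff, Prod.ext_iff]
      exact ⟨h1.trans h2.symm, (hc f h1).trans (hc g h2).symm⟩
    all_goals simp [F, h1, h2] at hfg
    rw [Sum.inl.injEq, Subtype.ext_iff, Prod.ext_iff]
    exact hfg
  · by_cases h1 : f.1.1 = e <;> simp [F, h1] at hfg
  · by_cases h1 : g.1.1 = e <;> simp [F, h1] at hfg
  · simpa [F, Subtype.ext_iff] using hfg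

omit [AddCommGroup N] in
open Classical in
theorem EdgesSeparate.satisfiesPsi_split [Finite E] [Fintype I] (hT : T.EdgesSeparate) {s : I → ℕ}
    (hs : T.SatisfiesPsi s) (e : E) (b : Bool) :
    (T.split e b).SatisfiesPsi (T.splitPsi s e b) := by
  intro v
  have h1 : T.ov v.1 ≤ (T.split e b).ov v := by
    have := hT.val_le_val_split e b v
    have h2 : (T.split e b).genus v = T.genus v.1 := rfl
    unfold ov
    rw [h2]
    omega
  refine le_trans ?_ ((hs v.1).trans h1)
  rw [Fintype.sum_option]
  have h0 : T.splitPsi s e b none = 0 := rfl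
  simp only [h0, Nat.cast_zero, ite_self, zero_add]
  let f : I → ℤ := fun i => if T.leg i = v.1 ∧ T.legWeight i = 0 then (s i : ℤ) else 0
  have hf : ∀ i, 0 ≤ f i := fun i => by
    simp only [f]
    split_ifs <;> positivity
  have h3 : ∑ i : {i // T.leg i ∈ T.side e b}, f i.1 ≤ ∑ i, f i := by
    rw [← Finset.sum_subtype (Finset.univ.filter fun i => T.leg i ∈ T.side e b) (by simp) f]
    exact Finset.sum_le_univ_sum_of_nonneg hf
  refine le_trans (le_of_eq (Finset.sum_congr rfl fun i _ => ?_)) (h3.trans (le_of_eq ?_))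
  · simp only [f]
    by_cases hi : T.leg i.1 = v.1 ∧ T.legWeight i.1 = 0
    · rw [if_pos hi, if_pos ⟨Subtype.ext hi.1, hi.2⟩]
      rfl
    · rw [if_neg hi, if_neg fun hi' => hi ⟨congrArg Subtype.val hi'.1, hi'.2⟩]
  · rfl

/-- The deformations of the component of `T` at the end `b` of `e`, as functions on all
vertices whose values outside of that component are arbitrary. -/
def IsSideTangent (T : CurveType N V E I) (L : I → Submodule ℝ (RealSpace N)) (e : E) (b : Bool)
    (c : V → RealSpace N) : Prop :=
  (∀ e', e' ≠ e → (∀ d, T.bdry e' d ∈ T.side e b) →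
    c (T.bdry e' true) - c (T.bdry e' false) ∈ Submodule.span ℝ {toReal N (T.dir e' false)}) ∧
  ∀ i, T.leg i ∈ T.side e b → c (T.leg i) ∈ L i

/-- The restriction of `h` is one curve of the split type, and around it all small deformations of
the component occur. So base points of the swept rays contribute the values of deformations at the
cut end, and the rays contribute the direction of the edge. -/
theorem EdgesSeparate.mem_vectorSpan_sweep [Finite E] [Fintype I] (hT : T.EdgesSeparate)
    (hneg : ∀ e b, T.dir e (!b) = -T.dir e b)
    {A : I → AffineSubspace ℝ (RealSpace N)} {s : I → ℕ} {h : V → RealSpace N}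
    (hh : h ∈ T.moduli A s) (e : E) (b : Bool) (x : RealSpace N) :
    x ∈ vectorSpan ℝ (T.sweep A s e b) ↔
      ∃ c, T.IsSideTangent (fun i => (A i).direction) e b c ∧
        x - c (T.bdry e b) ∈ Submodule.span ℝ {toReal N (T.dir e false)} := by
  classical
  have hspan : Submodule.span ℝ {toReal N (T.dir e b)} =
      Submodule.span ℝ {toReal N (T.dir e false)} := by
    cases b
    · rfl
    · rw [show T.dir e true = -T.dir e false from hneg e false, map_neg, ← Set.neg_singleton,
        Submodule.span_neg]
  rw [← hspan]
  set v₀ : {v // v ∈ T.side e b} := ⟨T.bdry e b, bdry_mem_side e b⟩ with hv₀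
  have hres : (fun v : {v // v ∈ T.side e b} => h v.1) ∈
      (T.split e b).moduli (T.splitConstraint A e b) (T.splitPsi s e b) := by
    refine ⟨fun e' => hh.1 e'.1, ?_, hT.satisfiesPsi_split hh.2.2 e b⟩
    rintro (_ | i)
    · exact fun x _ => trivial
    · exact hh.2.1 i.1
  have hsweep : ∀ h' ∈ (T.split e b).moduli (T.splitConstraint A e b) (T.splitPsi s e b),
      ∀ t : ℝ, 0 ≤ t → h' v₀ + t • toReal N (T.dir e b) ∈ T.sweep A s e b := by
    intro h' hh' t ht
    simp only [sweep, Set.mem_iUnion]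
    refine ⟨h', ?_, t, ht, rfl⟩
    convert hh'
  constructor
  · rw [vectorSpan_def]
    let K : Submodule ℝ (RealSpace N) :=
      ((T.split e b).tangent fun i => (T.splitConstraint A e b i).direction).map
        (LinearMap.proj v₀) ⊔ Submodule.span ℝ {toReal N (T.dir e b)}
    intro hx
    have hxK : x ∈ K := by
      refine Submodule.span_le.2 ?_ hx
      rintro _ ⟨y, hy, z, hz, rfl⟩
      simp only [sweep, Set.mem_iUnion] at hy hz
      obtain ⟨h1, hh1, t1, -, rfl⟩ := hy
      obtain ⟨h2, hh2, t2, -, rfl⟩ := hz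
      have := sub_mem_tangent_of_mem_moduli hh1 hh2
      refine Submodule.mem_sup.2 ⟨_, ⟨h1 - h2, this, rfl⟩, (t1 - t2) • toReal N (T.dir e b),
        Submodule.smul_mem _ _ (Submodule.mem_span_singleton_self _), ?_⟩
      change (h1 v₀ - h2 v₀) + _ = (h1 v₀ + t1 • toReal N (T.dir e b)) -
        (h2 v₀ + t2 • toReal N (T.dir e b))
      rw [sub_smul]
      abel
    obtain ⟨_, ⟨c, hc, rfl⟩, z, hz, rfl⟩ := Submodule.mem_sup.1 hxK
    -- The value 0 off the side is arbitrary; nothing there is constrained.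
    refine ⟨fun v => if hv : v ∈ T.side e b then c ⟨v, hv⟩ else 0, ⟨?_, ?_⟩, ?_⟩
    · intro e' he' hd
      simp only [hd, dif_pos]
      exact hc.1 ⟨e', he', hd⟩
    · intro i hi
      simp only [hi, dif_pos]
      exact hc.2 (some ⟨i, hi⟩)
    · simp only [bdry_mem_side, dif_pos]
      simpa [hv₀] using hz
  · rintro ⟨c, ⟨hc, hc'⟩, hx⟩
    have hct : (fun v : {v // v ∈ T.side e b} => c v.1) ∈
        (T.split e b).tangent fun i => (T.splitConstraint A e b i).direction := by
      refine ⟨fun e' => hc e'.1 e'.2.1 e'.2.2, ?_⟩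
      rintro (_ | i)
      · simp [splitConstraint]
      · exact hc' i.1 i.2
    have hb := hsweep _ hres 0 le_rfl
    -- The difference of the points at parameters 1 and 0 on the new ray.
    have hu : toReal N (T.dir e b) ∈ vectorSpan ℝ (T.sweep A s e b) := by
      have := vsub_mem_vectorSpan ℝ (hsweep _ hres 1 zero_le_one) hb
      simpa using this
    have hcv : c (T.bdry e b) ∈ vectorSpan ℝ (T.sweep A s e b) := by
      obtain ⟨ε, hε, hε0⟩ := ((eventually_nhdsWithin_of_eventually_nhds
        (eventually_add_smul_mem_moduli hres hct)).and
          (self_mem_nhdsWithin (s := {(0 : ℝ)}ᶜ))).exists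
      have := vsub_mem_vectorSpan ℝ (hsweep _ hε 0 le_rfl) hb
      have h1 : ε • c (T.bdry e b) ∈ vectorSpan ℝ (T.sweep A s e b) := by
        simpa [hv₀] using this
      exact (Submodule.smul_mem_iff _ hε0).1 h1
    have := Submodule.add_mem _ ((Submodule.span_singleton_le_iff_mem _ _).2 hu hx) hcv
    simpa using this

end CurveType
end Tropical

/-! ### Lattice points of real subspaces, ranks and finite index -/

namespace Tropical

section Lattice

variable {N : Type*} [AddCommGroup N]

theorem mem_latticePart {W : Submodule ℝ (RealSpace N)} {n : N} :
    n ∈ latticePart W ↔ toReal N n ∈ W := Iff.rfl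

theorem exists_real_extension (ψ : N →ₗ[ℤ] ℤ) :
    ∃ Ψ : RealSpace N →ₗ[ℝ] ℝ, ∀ n, Ψ (toReal N n) = ψ n :=
  ⟨(TensorProduct.AlgebraTensorModule.rid ℤ ℝ ℝ).toLinearMap ∘ₗ ψ.baseChange ℝ, fun n => by
    change TensorProduct.AlgebraTensorModule.rid ℤ ℝ ℝ (ψ.baseChange ℝ (1 ⊗ₜ[ℤ] n)) = ψ n
    simp⟩

theorem toReal_smul (k : ℤ) (n : N) : toReal N (k • n) = (k : ℝ) • toReal N n := by
  rw [map_smul, Int.cast_smul_eq_zsmul]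

instance isTorsionFree_quotient_latticePart (W : Submodule ℝ (RealSpace N)) :
    Module.IsTorsionFree ℤ (N ⧸ latticePart W) := by
  refine Module.IsTorsionFree.of_smul_eq_zero fun k x => ?_
  induction x using Submodule.Quotient.induction_on with
  | _ n =>
    intro h
    rw [← Submodule.Quotient.mk_smul, Submodule.Quotient.mk_eq_zero, mem_latticePart,
      toReal_smul] at h
    by_cases hk : k = 0
    · exact Or.inl hk
    · right
      rw [Submodule.Quotient.mk_eq_zero, mem_latticePart]
      exact (Submodule.smul_mem_iff _ (Int.cast_ne_zero.2 hk)).1 h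

variable [Module.Free ℤ N] [Module.Finite ℤ N]

omit [Module.Finite ℤ N] in
variable (N) in
theorem toReal_injective : Function.Injective (toReal N) := by
  rw [injective_iff_map_eq_zero]
  intro n hn
  refine (Module.Free.chooseBasis ℤ N).ext_elem fun i => ?_
  obtain ⟨Ψ, hΨ⟩ := exists_real_extension ((Module.Free.chooseBasis ℤ N).coord i)
  have := hΨ n
  rw [hn, map_zero] at this
  simpa using this.symm

omit [Module.Finite ℤ N] in
variable (N) in
theorem finrank_realSpace : Module.finrank ℝ (RealSpace N) = Module.finrank ℤ N :=
  Module.finrank_baseChange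

instance : Module.Free ℤ (N ⧸ latticePart (W : Submodule ℝ (RealSpace N))) :=
  Module.free_of_finite_type_torsion_free'

/-- The values of all functionals at `u` form an ideal `(g)` of ℤ. Since `g` divides every
coordinate of `u`, primitivity forces g = ±1. -/
theorem exists_functional_eq_one {u : N} (hu : IsPrimitive u) : ∃ ψ : N →ₗ[ℤ] ℤ, ψ u = 1 := by
  let ev : (N →ₗ[ℤ] ℤ) →ₗ[ℤ] ℤ := LinearMap.applyₗ u
  obtain ⟨g, hg⟩ := (IsPrincipalIdealRing.principal (LinearMap.range ev)).principal
  let b := Module.Free.chooseBasis ℤ N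
  have hdvd : ∀ i, ∃ a, b.coord i u = a * g := fun i => by
    have : b.coord i u ∈ LinearMap.range ev := ⟨b.coord i, rfl⟩
    rw [hg, Submodule.mem_span_singleton] at this
    obtain ⟨a, ha⟩ := this
    exact ⟨a, ha.symm⟩
  choose a ha using hdvd
  have hug : u = g • ∑ i, a i • b i := by
    conv_lhs => rw [← b.sum_repr u]
    rw [Finset.smul_sum]
    refine Finset.sum_congr rfl fun i _ => ?_
    rw [smul_smul, mul_comm, ← ha i, Module.Basis.coord_apply]
  have hg1 : g.natAbs = 1 := by
    rcases Int.natAbs_eq g with h | h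
    · refine hu.2 g.natAbs (∑ i, a i • b i) ?_
      rw [← natCast_zsmul, ← h]
      exact hug
    · refine hu.2 g.natAbs (-∑ i, a i • b i) ?_
      rw [← natCast_zsmul, smul_neg, ← neg_smul, ← h]
      exact hug
  have h1 : (1 : ℤ) ∈ LinearMap.range ev := by
    rw [hg, Submodule.mem_span_singleton]
    rcases Int.natAbs_eq g with h | h
    · exact ⟨1, by rw [h, hg1]; rfl⟩
    · exact ⟨-1, by rw [h, hg1]; rfl⟩
  exact h1

/-- A functional with value 1 on `u` reads off the real coefficient of a lattice point on the line,
which is therefore an integer. -/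
theorem latticePart_span_singleton {u : N} (hu : IsPrimitive u) :
    latticePart (Submodule.span ℝ {toReal N u}) = Submodule.span ℤ {u} := by
  ext n
  rw [mem_latticePart, Submodule.mem_span_singleton, Submodule.mem_span_singleton]
  constructor
  · rintro ⟨r, hr⟩
    obtain ⟨ψ, hψ⟩ := exists_functional_eq_one hu
    obtain ⟨Ψ, hΨ⟩ := exists_real_extension ψ
    have h1 : r = ψ n := by
      rw [← hΨ, ← hr, map_smul, hΨ, hψ]
      simp
    refine ⟨ψ n, toReal_injective N ?_⟩
    rw [toReal_smul, ← h1, hr]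
  · rintro ⟨k, rfl⟩
    exact ⟨k, (toReal_smul k u).symm⟩

theorem IsRational.finrank_le {W : Submodule ℝ (RealSpace N)} (hW : IsRational W) :
    Module.finrank ℝ W ≤ Module.finrank ℤ (latticePart W) := by
  let b := Module.finBasis ℤ (latticePart W)
  have : W ≤ Submodule.span ℝ (Set.range fun i => toReal N (b i : N)) := by
    conv_lhs => rw [← hW]
    rw [Submodule.span_le]
    rintro _ ⟨n, hn, rfl⟩
    have h1 := congrArg (fun x : latticePart W => toReal N (x : N)) (b.sum_repr ⟨n, hn⟩)
    simp only [AddSubmonoidClass.coe_finsetSum, map_sum, SetLike.val_smul, toReal_smul] at h1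
    rw [SetLike.mem_coe, ← h1]
    exact Submodule.sum_mem _ fun i _ =>
      Submodule.smul_mem _ _ (Submodule.subset_span ⟨i, rfl⟩)
  calc Module.finrank ℝ W ≤ _ := Submodule.finrank_mono this
    _ ≤ Fintype.card _ := finrank_range_le_card _
    _ = _ := by simp

theorem IsRational.finrank_quotient_latticePart_le {W : Submodule ℝ (RealSpace N)}
    (hW : IsRational W) :
    Module.finrank ℤ (N ⧸ latticePart W) ≤ Module.finrank ℝ (RealSpace N ⧸ W) := by
  have h1 := (latticePart W).finrank_quotient_add_finrank
  have h2 := W.finrank_quotient_add_finrank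
  have h3 := hW.finrank_le
  rw [finrank_realSpace] at h2
  omega

/-- The cokernel is finitely generated of rank 0, hence torsion, hence finite. -/
theorem mapIndex_ne_zero_of_injective {A B : Type*} [AddCommGroup A] [AddCommGroup B]
    [Module.Finite ℤ B] {f : A →ₗ[ℤ] B} (hf : Function.Injective f)
    (h : Module.finrank ℤ B ≤ Module.finrank ℤ A) : mapIndex f ≠ 0 := by
  have h1 := (LinearMap.range f).finrank_quotient_add_finrank
  rw [LinearMap.finrank_range_of_inj hf] at h1
  have h2 : Module.finrank ℤ (B ⧸ LinearMap.range f) = 0 := by omega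
  have : Finite (B ⧸ LinearMap.range f) :=
    Module.finite_of_fg_torsion _ (Module.finrank_eq_zero_iff_isTorsion.1 h2)
  have : Finite (B ⧸ (LinearMap.range f).toAddSubgroup) := this
  exact AddSubgroup.index_ne_zero_of_finite

end Lattice

/-! ### Dimension counts in genus zero -/

namespace CurveType

variable {N V E I : Type*} [AddCommGroup N] {T : CurveType N V E I}

omit [AddCommGroup N] in
theorem card_add_one_eq_of_totalGenus_eq_zero [Fintype V] [Fintype E]
    (hg : T.totalGenus = 0) (h0 : ∀ v, T.genus v = 0) : Fintype.card E + 1 = Fintype.card V := by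
  simp only [totalGenus, h0] at hg
  simp at hg
  omega

omit [AddCommGroup N] in
theorem sum_val [Fintype V] [Fintype E] [Fintype I] :
    ∑ v, T.val v = 2 * Fintype.card E + Fintype.card I := by
  classical
  simp only [val, Nat.card_eq_fintype_card]
  rw [Finset.sum_add_distrib, ← Fintype.card_sigma, ← Fintype.card_sigma,
    Fintype.card_congr (Equiv.sigmaFiberEquiv fun f : E × Bool => T.bdry f.1 f.2),
    Fintype.card_congr (Equiv.sigmaFiberEquiv T.leg), Fintype.card_prod, Fintype.card_bool,
    mul_comm]

/-- Insert #V = #E + 1 and ∑ val = 2#E + #I: the number of legs cancels. -/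
theorem expectedDim_eq [Fintype V] [Fintype E] [Fintype I]
    (hg : T.totalGenus = 0) (h0 : ∀ v, T.genus v = 0) :
    T.expectedDim = Module.finrank ℤ N + Fintype.card E := by
  have h1 := card_add_one_eq_of_totalGenus_eq_zero hg h0
  have h2 := T.sum_val
  have h3 : ∑ v, T.ov v = (∑ v, T.val v : ℕ) - 3 * (Fintype.card V : ℤ) := by
    simp only [ov, h0]
    simp [Finset.sum_sub_distrib, mul_comm]
  rw [expectedDim, h3, hg, h2]
  push_cast
  have : (Fintype.card V : ℤ) = Fintype.card E + 1 := by exact_mod_cast h1.symm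
  rw [this]
  ring

variable [Module.Free ℤ N] [Module.Finite ℤ N]

/-- A deformation is determined by the motion of one vertex and the changes of the edge vectors,
so that contracted edges make the space of tropical curves smaller. -/
theorem IsConnected.finrank_tangent_le [Fintype V] [Fintype E] (hT : T.IsConnected) :
    Module.finrank ℝ (T.tangent fun _ => ⊤) ≤ Module.finrank ℤ N +
      ∑ e, Module.finrank ℝ (Submodule.span ℝ {toReal N (T.dir e false)}) := by
  obtain ⟨v₀⟩ := hT.1
  let f : (T.tangent fun _ => ⊤) →ₗ[ℝ]
      RealSpace N × (∀ e, Submodule.span ℝ {toReal N (T.dir e false)}) :=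
    LinearMap.prod (LinearMap.proj v₀ ∘ₗ Submodule.subtype _) (LinearMap.pi fun e =>
      LinearMap.codRestrict _
        (((LinearMap.proj (T.bdry e true) : (V → RealSpace N) →ₗ[ℝ] RealSpace N) -
          LinearMap.proj (T.bdry e false)) ∘ₗ Submodule.subtype _) fun c => by simpa using c.2.1 e)
  have hf : Function.Injective f := by
    rw [injective_iff_map_eq_zero]
    rintro ⟨c, hc⟩ h
    have h0 : c v₀ = 0 := congrArg Prod.fst h
    have he : ∀ e, c (T.bdry e true) - c (T.bdry e false) = 0 := fun e =>
      congrArg Subtype.val (congrFun (congrArg Prod.snd h) e)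
    ext v
    refine hT.induction v₀ (P := fun v => c v = 0) h0 ?_ v
    rintro e (_ | _) h
    · have := he e
      rw [h] at this
      simpa using this
    · have := he e
      rw [h] at this
      simpa using this
  have := LinearMap.finrank_le_finrank_of_injective hf
  rwa [Module.finrank_prod, Module.finrank_pi_fintype, finrank_realSpace] at this

omit [Module.Free ℤ N] [Module.Finite ℤ N] in
theorem IsNonSuperabundant.finrank_tangent [Fintype V] [Fintype E] [Fintype I]
    (hns : T.IsNonSuperabundant) (hne : T.cell.Nonempty) (hg : T.totalGenus = 0) :
    Module.finrank ℝ (T.tangent fun _ => ⊤) = Module.finrank ℤ N + Fintype.card E := by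
  have := hns.2.2
  rw [vectorSpan_cell hne, expectedDim_eq hg hns.2.1] at this
  exact_mod_cast this

/-- A contracted edge has no length to vary, so it would push the dimension of the deformation space
below `r + #E`. Thus non-superabundance in genus 0 excludes every contracted compact edge. -/
theorem IsNonSuperabundant.dir_ne_zero [Fintype V] [Fintype E] [Fintype I]
    (hns : T.IsNonSuperabundant) (hne : T.cell.Nonempty) (hg : T.totalGenus = 0)
    (hT : T.IsConnected) (e : E) : T.dir e false ≠ 0 := by
  intro h0
  have h1 := hns.finrank_tangent hne hg
  have h2 := hT.finrank_tangent_le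
  have h3 : ∑ e, Module.finrank ℝ (Submodule.span ℝ {toReal N (T.dir e false)}) <
      ∑ _ : E, 1 := by
    refine Finset.sum_lt_sum (fun e _ => ?_) ⟨e, Finset.mem_univ e, ?_⟩
    · simpa using finrank_span_le_card (R := ℝ) {toReal N (T.dir e false)}
    · rw [h0, map_zero, Submodule.span_zero_singleton, finrank_bot]
      exact one_pos
  simp only [Finset.sum_const, Finset.card_univ, smul_eq_mul, mul_one] at h3
  omega

-- A kernel element of `Φ` is an integral deformation that preserves the constraints.
omit [Module.Finite ℤ N] in
theorem phi_injective {A : I → AffineSubspace ℝ (RealSpace N)}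
    (hA : T.tangent (fun i => (A i).direction) = ⊥) : Function.Injective (T.Phi A) := by
  rw [injective_iff_map_eq_zero]
  intro H hH
  have h1 : (fun v => toReal N (H v)) ∈ T.tangent fun i => (A i).direction := by
    constructor
    · intro e
      have : (T.edgeLattice e).mkQ (H (T.bdry e true) - H (T.bdry e false)) = 0 :=
        congrFun (congrArg Prod.fst hH) e
      rw [Submodule.mkQ_apply, Submodule.Quotient.mk_eq_zero, edgeLattice, mem_latticePart,
        map_sub] at this
      exact this
    · intro i
      have : (latticePart (A i).direction).mkQ (H (T.leg i)) = 0 :=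
        congrFun (congrArg Prod.snd hH) i
      rwa [Submodule.mkQ_apply, Submodule.Quotient.mk_eq_zero, mem_latticePart] at this
  rw [hA, Submodule.mem_bot] at h1
  ext v
  exact toReal_injective N ((congrFun h1 v).trans (map_zero _).symm)

/-- The target of `Φ` has rank at most `#E (r − 1) + ∑ codim A_i = #E (r − 1) + r + #E = r #V`, the
rank of its source. -/
theorem latticeMult_ne_zero [Fintype V] [Fintype E] [Fintype I]
    {A : I → AffineSubspace ℝ (RealSpace N)} (hrat : ∀ i, IsRational (A i).direction)
    (hA : T.tangent (fun i => (A i).direction) = ⊥) (hg : T.totalGenus = 0)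
    (h0 : ∀ v, T.genus v = 0) (hcodim : T.HasComplementaryCodim A)
    (hdir : ∀ e, T.dir e false ≠ 0) : T.latticeMult A ≠ 0 := by
  have hE : ∀ e, Module.Free ℤ (N ⧸ T.edgeLattice e) := fun e => by
    unfold edgeLattice; infer_instance
  refine mapIndex_ne_zero_of_injective (phi_injective hA) ?_
  rw [Module.finrank_prod, Module.finrank_pi_fintype, Module.finrank_pi_fintype,
    Module.finrank_pi_fintype]
  have h1 : ∀ e, Module.finrank ℤ (N ⧸ T.edgeLattice e) + 1 ≤ Module.finrank ℤ N := fun e => by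
    have h2 := (T.edgeLattice e).finrank_quotient_add_finrank
    have h3 : Module.finrank ℤ (T.edgeLattice e) ≠ 0 := fun h => by
      rw [Submodule.finrank_eq_zero] at h
      have : T.dir e false ∈ T.edgeLattice e := Submodule.mem_span_singleton_self _
      rw [h, Submodule.mem_bot] at this
      exact hdir e this
    omega
  have h2 := Finset.sum_le_sum fun e (_ : e ∈ Finset.univ) => h1 e
  have h3 := Finset.sum_le_sum fun i (_ : i ∈ Finset.univ) =>
    (hrat i).finrank_quotient_latticePart_le
  have h4 : ∑ i, Module.finrank ℝ (RealSpace N ⧸ (A i).direction) =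
      Module.finrank ℤ N + Fintype.card E := by
    have := hcodim
    rw [HasComplementaryCodim, expectedDim_eq hg h0] at this
    exact_mod_cast this
  rw [Finset.sum_add_distrib] at h2
  simp only [Finset.sum_const, Finset.card_univ, smul_eq_mul, mul_one] at h2 ⊢
  rw [← card_add_one_eq_of_totalGenus_eq_zero hg h0, add_mul, one_mul]
  omega

end CurveType
end Tropical

/-! ### Linear systems with generic right-hand side -/

namespace Tropical

theorem injective_of_surjective_of_finrank_eq_sum {K M ι : Type*} [Field K] [AddCommGroup M]
    [Module K M] [FiniteDimensional K M] [Fintype ι] {Q : ι → Type*} [∀ i, AddCommGroup (Q i)]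
    [∀ i, Module K (Q i)] [∀ i, FiniteDimensional K (Q i)] (f : M →ₗ[K] ∀ i, Q i)
    (hf : Function.Surjective f) (h : Module.finrank K M = ∑ i, Module.finrank K (Q i)) :
    Function.Injective f := by
  rw [← Module.finrank_pi_fintype] at h
  exact (LinearMap.injective_iff_surjective_of_finrank_eq_finrank h).2 hf

/-- Outside of a proper affine subspace of translates `a`, a system of `dim C` linear equations
`c (leg i) ≡ a i` modulo `L i` on a vector space `C` has at most one solution. -/
theorem exists_finite_forall_unique {K R V I : Type*} [Field K] [AddCommGroup R] [Module K R]
    [FiniteDimensional K R] [Finite V] [Fintype I] (C : Submodule K (V → R))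
    (L : I → Submodule K R) (leg : I → V) :
    ∃ F : Set (AffineSubspace K (I → R)), F.Finite ∧ (∀ B ∈ F, B ≠ ⊤) ∧
      ∀ a : I → R, (∀ B ∈ F, a ∉ B) →
        Module.finrank K C = ∑ i, Module.finrank K (R ⧸ L i) →
        ∀ c ∈ C, (∀ i, c (leg i) - a i ∈ L i) → ∀ c' ∈ C, (∀ i, c' (leg i) - a i ∈ L i) →
          c = c' := by
  let quot : (I → R) →ₗ[K] (∀ i, R ⧸ L i) :=
    LinearMap.pi fun i => (L i).mkQ ∘ₗ LinearMap.proj i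
  let ev : (V → R) →ₗ[K] (I → R) := LinearMap.pi fun i => LinearMap.proj (leg i)
  let f : C →ₗ[K] (∀ i, R ⧸ L i) := quot ∘ₗ ev ∘ₗ C.subtype
  -- `B` is the space of translates for which the system is solvable. If it is proper, it is the
  -- exceptional set and generic systems have no solution; if it is everything, `f` is surjective
  -- and the dimension count makes it injective.
  let B : Submodule K (I → R) := (LinearMap.range f).comap quot
  refine ⟨{B.toAffineSubspace} \ {⊤}, (Set.finite_singleton _).subset Set.sdiff_subset,
    fun B' hB' => hB'.2, fun a ha hdim c hc hca c' hc' hca' => ?_⟩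
  have hf : ∀ c (hc : c ∈ C), (∀ i, c (leg i) - a i ∈ L i) → f ⟨c, hc⟩ = quot a :=
    fun c hc h => funext fun i => (Submodule.Quotient.eq _).2 (h i)
  have haB : a ∈ B := ⟨⟨c, hc⟩, hf c hc hca⟩
  have hB : B = ⊤ := by
    by_contra hne
    refine ha B.toAffineSubspace ⟨rfl, fun h => hne ?_⟩ haB
    rw [eq_top_iff]
    intro x _
    have hx : x ∈ B.toAffineSubspace := by
      rw [Set.mem_singleton_iff.1 h]; exact AffineSubspace.mem_top K _ x
    exact hx
  have hsurj : Function.Surjective f := by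
    intro y
    choose x hx using fun i => (L i).mkQ_surjective (y i)
    have hxB : x ∈ B := hB ▸ Submodule.mem_top
    obtain ⟨c, hc⟩ := hxB
    exact ⟨c, hc.trans (funext hx)⟩
  have hinj := injective_of_surjective_of_finrank_eq_sum f hsurj hdim
  exact congrArg Subtype.val (hinj ((hf c hc hca).trans (hf c' hc' hca').symm))

namespace CurveType

variable {N V E I : Type*} [AddCommGroup N] {T : CurveType N V E I}

/-! ### Generic constraints -/

/-- For translates outside of a proper affine subspace, the non-superabundant curves which satisfy
constraints of complementary codimension are rigid. -/
theorem exists_finite_forall_isRigid [Module.Free ℤ N] [Module.Finite ℤ N]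
    [Fintype V] [Fintype E] [Fintype I]
    (L : I → Submodule ℝ (RealSpace N)) (s : I → ℕ) :
    ∃ F : Set (AffineSubspace ℝ (I → RealSpace N)), F.Finite ∧ (∀ B ∈ F, B ≠ ⊤) ∧
      ∀ a : I → RealSpace N, (∀ B ∈ F, a ∉ B) →
        ∀ h ∈ T.moduli (fun i => AffineSubspace.mk' (a i) (L i)) s,
          T.IsNonSuperabundant →
          T.HasComplementaryCodim (fun i => AffineSubspace.mk' (a i) (L i)) →
          T.IsRigid (fun i => AffineSubspace.mk' (a i) (L i)) s h := by
  obtain ⟨F, hF, hF', huniq⟩ := exists_finite_forall_unique (T.tangent fun _ => ⊤) L T.leg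
  refine ⟨F, hF, hF', fun a ha h hh hns hcodim => ⟨hh, hns, hcodim, ?_⟩⟩
  have hleg : ∀ h' ∈ T.moduli (fun i => AffineSubspace.mk' (a i) (L i)) s, ∀ i,
      h' (T.leg i) - a i ∈ L i := fun h' hh' i => by
    have := apply_leg_mem_of_mem_moduli hh' i
    rwa [AffineSubspace.mem_mk', vsub_eq_sub] at this
  -- A curve has its edges along the prescribed directions, so it is itself a deformation vector and
  -- the linear uniqueness statement applies to it.
  have hcell : ∀ h' ∈ T.cell, h' ∈ T.tangent fun _ => ⊤ := fun h' hh' =>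
    ⟨fun e => by
      obtain ⟨t, -, ht⟩ := hh' e
      exact Submodule.mem_span_singleton.2 ⟨t, ht.symm⟩, fun _ => trivial⟩
  have hdim : Module.finrank ℝ (T.tangent fun _ => ⊤) =
      ∑ i, Module.finrank ℝ (RealSpace N ⧸ L i) := by
    rw [← vectorSpan_cell ⟨h, hh.1⟩]
    have h1 := hns.2.2
    rw [← show _ = _ from hcodim] at h1
    have h2 : ∀ i, Module.finrank ℝ (RealSpace N ⧸ (AffineSubspace.mk' (a i) (L i)).direction) =
        Module.finrank ℝ (RealSpace N ⧸ L i) := fun i => by rw [AffineSubspace.direction_mk']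
    simp only [h2] at h1
    exact_mod_cast h1
  exact isIsolated_of_subsingleton (fun h₁ hh₁ h₂ hh₂ =>
    huniq a ha hdim h₁ (hcell h₁ hh₁.1) (hleg h₁ hh₁) h₂ (hcell h₂ hh₂.1) (hleg h₂ hh₂)) hh

/-! ### The lattices swept out by the two halves of an edge -/

section Sweep

variable [Finite E] [Fintype I] {A : I → AffineSubspace ℝ (RealSpace N)} {s : I → ℕ}
  {h : V → RealSpace N}

theorem EdgesSeparate.mem_sweepLattice (hT : T.EdgesSeparate)
    (hneg : ∀ e b, T.dir e (!b) = -T.dir e b) (hh : h ∈ T.moduli A s) {e : E} {b : Bool} {n : N} :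
    n ∈ T.sweepLattice A s e b ↔
      ∃ c, T.IsSideTangent (fun i => (A i).direction) e b c ∧
        toReal N n - c (T.bdry e b) ∈ Submodule.span ℝ {toReal N (T.dir e false)} :=
  hT.mem_vectorSpan_sweep hneg hh e b _

theorem EdgesSeparate.edgeLattice_le_sweepLattice (hT : T.EdgesSeparate)
    (hneg : ∀ e b, T.dir e (!b) = -T.dir e b) (hh : h ∈ T.moduli A s) (e : E) (b : Bool) :
    T.edgeLattice e ≤ T.sweepLattice A s e b := by
  intro n hn
  rw [hT.mem_sweepLattice hneg hh]
  refine ⟨0, ⟨by simp, by simp⟩, ?_⟩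
  rw [Pi.zero_apply, sub_zero]
  exact hn

theorem EdgesSeparate.apply_bdry_mem_sweepLattice (hT : T.EdgesSeparate)
    (hneg : ∀ e b, T.dir e (!b) = -T.dir e b) (hh : h ∈ T.moduli A s) {e : E} {H : V → N}
    (hH : ∀ e', e' ≠ e → H (T.bdry e' true) - H (T.bdry e' false) ∈ T.edgeLattice e')
    (hH' : ∀ i, H (T.leg i) ∈ latticePart (A i).direction) (b : Bool) :
    H (T.bdry e b) ∈ T.sweepLattice A s e b := by
  rw [hT.mem_sweepLattice hneg hh]
  refine ⟨fun v => toReal N (H v), ⟨fun e' he' _ => ?_, fun i _ => hH' i⟩, by simp⟩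
  rw [← map_sub]
  exact hH e' he'

/-- Deformations of the two halves of an edge glue. -/
theorem EdgesSeparate.mem_edgeLattice_of_mem_sweepLattice (hT : T.EdgesSeparate)
    (hconn : T.IsConnected) (hneg : ∀ e b, T.dir e (!b) = -T.dir e b) (hh : h ∈ T.moduli A s)
    (htan : T.tangent (fun i => (A i).direction) = ⊥) {e : E} {n : N}
    (hn : ∀ b, n ∈ T.sweepLattice A s e b) : n ∈ T.edgeLattice e := by
  classical
  obtain ⟨c₁, ⟨hc₁, hc₁'⟩, hn₁⟩ := (hT.mem_sweepLattice hneg hh).1 (hn true)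
  obtain ⟨c₂, ⟨hc₂, hc₂'⟩, hn₂⟩ := (hT.mem_sweepLattice hneg hh).1 (hn false)
  -- Both halves take the value `n` at their end modulo the edge direction, so the glued map is a
  -- constrained deformation of the whole curve. It vanishes, leaving `n` on the line of `e`.
  let c : V → RealSpace N := fun v => if v ∈ T.side e true then c₁ v else c₂ v
  have hct : ∀ v ∈ T.side e true, c v = c₁ v := fun v hv => if_pos hv
  have hcf : ∀ v ∈ T.side e false, c v = c₂ v := fun v hv => if_neg (hT.not_mem_side hv)
  have hends : ∀ e' b d, e' ≠ e → T.bdry e' true ∈ T.side e b → T.bdry e' d ∈ T.side e b := by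
    intro e' b d he' hm
    cases d
    · exact bdry_other_mem_side he' hm
    · exact hm
  have hc : c ∈ T.tangent fun i => (A i).direction := by
    constructor
    · intro e'
      by_cases he' : e' = e
      · subst he'
        rw [hct _ (bdry_mem_side _ _), hcf _ (bdry_mem_side _ _)]
        have := Submodule.sub_mem _ hn₂ hn₁
        rwa [sub_sub_sub_cancel_left] at this
      · rcases hconn.mem_side_or e true (T.bdry e' true) with hm | hm
        · have := fun d => hends e' true d he' hm
          rw [hct _ (this _), hct _ (this _)]
          exact hc₁ e' he' this
        · have := fun d => hends e' false d he' hm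
          rw [hcf _ (this _), hcf _ (this _)]
          exact hc₂ e' he' this
    · intro i
      rcases hconn.mem_side_or e true (T.leg i) with hm | hm
      · rw [hct _ hm]; exact hc₁' i hm
      · rw [hcf _ hm]; exact hc₂' i hm
  rw [htan, Submodule.mem_bot] at hc
  rw [← hct _ (bdry_mem_side _ _), hc, Pi.zero_apply, sub_zero] at hn₁
  exact hn₁

/-- Deformations of the branches at a vertex glue. -/
theorem EdgesSeparate.mem_sweepLattice_of_branches (hT : T.EdgesSeparate)
    (hconn : T.IsConnected) (hneg : ∀ e b, T.dir e (!b) = -T.dir e b) (hh : h ∈ T.moduli A s)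
    {e : E} {b : Bool} {n : N}
    (hn : ∀ e' c, T.bdry e' c = T.bdry e b → (e', c) ≠ (e, b) → n ∈ T.sweepLattice A s e' (!c))
    (hn' : ∀ i, T.leg i = T.bdry e b → n ∈ latticePart (A i).direction) :
    n ∈ T.sweepLattice A s e b := by
  classical
  have hn₂ : ∀ f : E × Bool, ∃ c : V → RealSpace N, T.bdry f.1 f.2 = T.bdry e b → f ≠ (e, b) →
      T.IsSideTangent (fun i => (A i).direction) f.1 (!f.2) c ∧
        toReal N n - c (T.bdry f.1 !f.2) ∈ Submodule.span ℝ {toReal N (T.dir f.1 false)} := by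
    intro f
    by_cases hf : T.bdry f.1 f.2 = T.bdry e b ∧ f ≠ (e, b)
    · obtain ⟨c, hc⟩ := (hT.mem_sweepLattice hneg hh).1 (hn f.1 f.2 hf.1 hf.2)
      exact ⟨c, fun _ _ => hc⟩
    · exact ⟨0, fun h1 h2 => (hf ⟨h1, h2⟩).elim⟩
  choose cf hcf using hn₂
  let IsBranch : E × Bool → V → Prop := fun f v => T.bdry f.1 f.2 = T.bdry e b ∧ v ∈ T.side f.1 (!f.2)
  have huniq : ∀ f g v, IsBranch f v → IsBranch g v → f = g := fun f g v hf hg =>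
    hT.branch_unique (hf.1.trans hg.1.symm) hg.2 hf.2
  -- The root moves by `n`, and each branch by a deformation that matches `n` at its end modulo the
  -- connecting edge. By `huniq` the choice of a branch is no choice.
  let c : V → RealSpace N := fun v => if hv : ∃ f, IsBranch f v then cf hv.choose v else toReal N n
  have hcb : ∀ f v, IsBranch f v → c v = cf f v := by
    intro f v hf
    have hex : ∃ f, IsBranch f v := ⟨f, hf⟩
    simp only [c, dif_pos hex, huniq _ _ _ hex.choose_spec hf]
  have hroot : ∀ f, ¬ IsBranch f (T.bdry e b) := by
    rintro ⟨e', d⟩ ⟨h1, h2⟩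
    rw [← h1] at h2
    exact hT e' (!d) (by simpa using h2)
  have hc0 : c (T.bdry e b) = toReal N n := dif_neg fun ⟨f, hf⟩ => hroot f hf
  -- The branch at `(e, b)` itself carries no chosen deformation, but it does not meet this side.
  have hside : ∀ f v, v ∈ T.side e b → IsBranch f v → f ≠ (e, b) := by
    rintro f v hv hf rfl
    exact hT.not_mem_side hv hf.2
  have hrootedge : ∀ e' d, e' ≠ e → T.bdry e' d = T.bdry e b →
      c (T.bdry e' d) - c (T.bdry e' !d) ∈ Submodule.span ℝ {toReal N (T.dir e' false)} := by
    intro e' d he' hd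
    have hne : (e', d) ≠ (e, b) := fun h => he' (congrArg Prod.fst h)
    rw [hcb (e', d) (T.bdry e' !d) ⟨hd, bdry_mem_side _ _⟩, hd, hc0]
    exact (hcf (e', d) hd hne).2
  rw [hT.mem_sweepLattice hneg hh]
  refine ⟨c, ⟨fun e' he' hmem => ?_, fun i hi => ?_⟩, by simp [hc0]⟩
  -- An edge either touches the root or lies entirely in one branch.
  · by_cases h1 : ∃ d, T.bdry e' d = T.bdry e b
    · obtain ⟨_ | _, hd⟩ := h1
      · have := Submodule.neg_mem _ (hrootedge e' false he' hd)
        rwa [neg_sub] at this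
      · exact hrootedge e' true he' hd
    · push Not at h1
      obtain hv | ⟨f, d, hf, hv⟩ := hconn.exists_branch (T.bdry e b) (T.bdry e' true)
      · exact (h1 _ hv).elim
      · have hne : e' ≠ f := by
          rintro rfl
          exact h1 _ hf
        have hall : ∀ d', T.bdry e' d' ∈ T.side f (!d) := by
          rintro (_ | _)
          · exact bdry_other_mem_side hne hv
          · exact hv
        have hfd := hside (f, d) _ (hmem true) ⟨hf, hv⟩
        rw [hcb (f, d) _ ⟨hf, hall true⟩, hcb (f, d) _ ⟨hf, hall false⟩]
        exact (hcf (f, d) hf hfd).1.1 e' hne hall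
  · obtain hv | ⟨f, d, hf, hv⟩ := hconn.exists_branch (T.bdry e b) (T.leg i)
    · rw [hv, hc0]
      exact hn' i hv
    · rw [hcb (f, d) _ ⟨hf, hv⟩]
      exact (hcf (f, d) hf (hside (f, d) _ hi ⟨hf, hv⟩)).1.2 i hv

/-- If on the side `b` of `e` every flag and leg satisfies its congruence, where the congruence at
a flag may be either the one on the position of its vertex or the one on the edge vector, then the
position of the end of `e` satisfies the congruence which this side induces. -/
theorem EdgesSeparate.apply_bdry_mem_sweepLattice_of_side [Finite V] (hT : T.EdgesSeparate)
    (hconn : T.IsConnected) (hneg : ∀ e b, T.dir e (!b) = -T.dir e b) (hh : h ∈ T.moduli A s)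
    (H : V → N) (e : E) (b : Bool)
    (hflag : ∀ e' c, e' ≠ e → T.bdry e' c ∈ T.side e b →
      H (T.bdry e' c) ∈ T.sweepLattice A s e' (!c) ∨
      H (T.bdry e' true) - H (T.bdry e' false) ∈ T.sweepLattice A s e' (!c))
    (hleg : ∀ i, T.leg i ∈ T.side e b → H (T.leg i) ∈ latticePart (A i).direction) :
    H (T.bdry e b) ∈ T.sweepLattice A s e b := by
  -- Each branch at the root is smaller than the side, because it omits the root.
  induction hk : (T.side e b).ncard using Nat.strong_induction_on generalizing e b with
  | _ k ih =>
  refine hT.mem_sweepLattice_of_branches hconn hneg hh (fun e' c hv hne => ?_) fun i hi => ?_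
  · have he' := hT.edge_ne hv hne
    have hsub := hT.branch_subset hv hne
    have hroot : T.bdry e b ∉ T.side e' (!c) := by
      rw [← hv]; simpa using hT e' (!c)
    have h1 : H (T.bdry e' !c) ∈ T.sweepLattice A s e' (!c) := by
      refine ih _ ?_ e' (!c) ?_ (fun i hi => hleg i (hsub hi)) rfl
      · rw [← hk]
        exact Set.ncard_lt_ncard
          (Set.ssubset_iff_of_subset hsub |>.2 ⟨_, bdry_mem_side e b, hroot⟩) (Set.toFinite _)
      · intro e'' d he'' hm
        refine hflag e'' d ?_ (hsub hm)
        rintro rfl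
        rcases Bool.eq_or_eq_not d b with rfl | rfl
        · exact hroot hm
        · exact hT e'' b (hsub hm)
    -- In the second case the position of the root is that of the far end, placed in `W` by
    -- induction, plus or minus the edge vector.
    rcases hflag e' c he' (hv ▸ bdry_mem_side e b) with h2 | h2
    · rwa [hv] at h2
    · rw [← hv]
      cases c
      · have := Submodule.sub_mem _ h1 h2
        simpa using this
      · have := Submodule.add_mem _ h2 h1
        simpa using this
  · rw [← hi]
    exact hleg i (hi ▸ bdry_mem_side e b)

end Sweep

end CurveType
end Tropical

namespace Tropical
namespace CurveType

variable {N V E I : Type*} [AddCommGroup N] {T : CurveType N V E I}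

/-! ### Multiplicities as indices of congruence subgroups -/

theorem latticeMult_eq_index (A : I → AffineSubspace ℝ (RealSpace N)) :
    T.latticeMult A = (congrSubgroup (A := V → N)
      (Sum.elim (fun e => LinearMap.proj (R := ℤ) (φ := fun _ => N) (T.bdry e true) -
        LinearMap.proj (T.bdry e false)) fun i => LinearMap.proj (T.leg i))
      (Sum.elim T.edgeLattice fun i => latticePart (A i).direction)).index := by
  let π : (E ⊕ I → N) →+ (∀ e, N ⧸ T.edgeLattice e) × (∀ i, N ⧸ latticePart (A i).direction) :=
    { toFun := fun x => (fun e => Submodule.Quotient.mk (x (.inl e)),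
        fun i => Submodule.Quotient.mk (x (.inr i)))
      map_zero' := rfl
      map_add' := fun _ _ => rfl }
  refine mapIndex_eq_index _ π ?_ _ fun x => ?_
  · rintro ⟨y, z⟩
    choose y' hy using fun e => (T.edgeLattice e).mkQ_surjective (y e)
    choose z' hz using fun i => (latticePart (A i).direction).mkQ_surjective (z i)
    exact ⟨Sum.elim y' z', Prod.ext (funext hy) (funext hz)⟩
  · rw [mem_congrSubgroup]
    refine exists_congr fun H => ?_
    rw [Sum.forall, eq_comm, Prod.ext_iff, funext_iff, funext_iff]
    exact and_congr (forall_congr' fun e => (Submodule.Quotient.eq _).symm)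
      (forall_congr' fun i => (Submodule.Quotient.eq _).symm)

theorem vertexMult_eq_index [Fintype I] (A : I → AffineSubspace ℝ (RealSpace N)) (s : I → ℕ)
    (v : V) : T.vertexMult A s v =
      (congrSubgroup (J := {f : E × Bool // T.bdry f.1 f.2 = v} ⊕ {i // T.leg i = v})
        (fun _ => LinearMap.id)
        (Sum.elim (fun f => T.sweepLattice A s f.1.1 (!f.1.2))
          fun i => latticePart (A i.1).direction)).index := by
  let π : ({f : E × Bool // T.bdry f.1 f.2 = v} ⊕ {i // T.leg i = v} → N) →+
      (∀ f : {f : E × Bool // T.bdry f.1 f.2 = v}, N ⧸ T.sweepLattice A s f.1.1 (!f.1.2)) ×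
      (∀ i : {i // T.leg i = v}, N ⧸ latticePart (A i.1).direction) :=
    { toFun := fun x => (fun e => Submodule.Quotient.mk (x (.inl e)),
        fun i => Submodule.Quotient.mk (x (.inr i)))
      map_zero' := rfl
      map_add' := fun _ _ => rfl }
  refine mapIndex_eq_index _ π ?_ _ fun x => ?_
  · rintro ⟨y, z⟩
    choose y' hy using fun f => (T.sweepLattice A s _ _).mkQ_surjective (y f)
    choose z' hz using fun i => (latticePart _).mkQ_surjective (z i)
    exact ⟨Sum.elim y' z', Prod.ext (funext hy) (funext hz)⟩
  · rw [mem_congrSubgroup]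
    refine exists_congr fun n => ?_
    rw [Sum.forall, eq_comm, Prod.ext_iff, funext_iff, funext_iff]
    exact and_congr (forall_congr' fun e => (Submodule.Quotient.eq _).symm)
      (forall_congr' fun i => (Submodule.Quotient.eq _).symm)

theorem edgeMult_eq_index [Fintype I] (A : I → AffineSubspace ℝ (RealSpace N)) (s : I → ℕ)
    (e : E) (hu : ∀ b, T.dir e false ∈ T.sweepLattice A s e b) : T.edgeMult A s e hu =
      (congrSubgroup (J := Bool) (fun _ => LinearMap.id)
        (fun b => T.sweepLattice A s e (!b))).index := by
  -- The coordinate `b` is taken modulo the lattice of the side `!b`, as for the flag `(e, b)` in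
  -- `flagLattice`.
  let π : (Bool → N) →+ (N ⧸ T.sweepLattice A s e true) × (N ⧸ T.sweepLattice A s e false) :=
    { toFun := fun x => (Submodule.Quotient.mk (x false), Submodule.Quotient.mk (x true))
      map_zero' := rfl
      map_add' := fun _ _ => rfl }
  refine mapIndex_eq_index _ π ?_ _ fun x => ?_
  · rintro ⟨y, z⟩
    obtain ⟨y', rfl⟩ := Submodule.mkQ_surjective _ y
    obtain ⟨z', rfl⟩ := Submodule.mkQ_surjective _ z
    exact ⟨fun b => if b then z' else y', rfl⟩
  · rw [mem_congrSubgroup, (Submodule.mkQ_surjective _).exists]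
    refine exists_congr fun n => ?_
    rw [Bool.forall_bool, eq_comm, Prod.ext_iff]
    exact and_congr (Submodule.Quotient.eq _).symm (Submodule.Quotient.eq _).symm

/-! ### The multiplicity formula -/

section Formula

variable [Fintype V] [Fintype E] [Fintype I] {A : I → AffineSubspace ℝ (RealSpace N)} {s : I → ℕ}
  {h : V → RealSpace N}

/-- The lattice by which the entry at a flag or leg is divided. -/
def flagLattice (T : CurveType N V E I) (A : I → AffineSubspace ℝ (RealSpace N)) (s : I → ℕ) :
    (E × Bool) ⊕ I → Submodule ℤ N :=
  Sum.elim (fun f => T.sweepLattice A s f.1 (!f.2)) fun i => latticePart (A i).direction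

/-- The position of the vertex of a flag or leg. -/
def position (T : CurveType N V E I) : (E × Bool) ⊕ I → (V → N) →ₗ[ℤ] N :=
  Sum.elim (fun f => LinearMap.proj (T.bdry f.1 f.2)) fun i => LinearMap.proj (T.leg i)

/-- The edge vector at a flag, and the position of the vertex of a leg. -/
def edgeVector (T : CurveType N V E I) : (E × Bool) ⊕ I → (V → N) →ₗ[ℤ] N :=
  Sum.elim (fun f => LinearMap.proj (R := ℤ) (φ := fun _ => N) (T.bdry f.1 true) -
    LinearMap.proj (T.bdry f.1 false)) fun i => LinearMap.proj (T.leg i)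

-- The congruences at the flags and legs of `v` involve only `H v`, so the position map is block
-- diagonal over the vertices.
omit [Fintype E] in
theorem prod_vertexMult_eq_index :
    ∏ v, T.vertexMult A s v = (congrSubgroup T.position (T.flagLattice A s)).index := by
  classical
  simp_rw [vertexMult_eq_index]
  symm
  let ρ : ∀ v, ((E × Bool) ⊕ I → N) →+
      ({f : E × Bool // T.bdry f.1 f.2 = v} ⊕ {i // T.leg i = v} → N) := fun v =>
    { toFun := fun x => Sum.elim (fun f => x (.inl f.1)) fun i => x (.inr i.1)
      map_zero' := by ext (_ | _) <;> rfl
      map_add' := fun _ _ => by ext (_ | _) <;> rfl }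
  refine index_eq_prod_of_forall_mem ρ (fun y => ?_) _ _ fun x => ?_
  · refine ⟨Sum.elim (fun f => y _ (.inl ⟨f, rfl⟩)) fun i => y _ (.inr ⟨i, rfl⟩), fun v => ?_⟩
    ext (⟨f, rfl⟩ | ⟨i, rfl⟩) <;> rfl
  · constructor
    · rintro ⟨H, hH⟩ v
      refine ⟨H v, ?_⟩
      rintro (⟨f, rfl⟩ | ⟨i, rfl⟩)
      · exact hH (.inl f)
      · exact hH (.inr i)
    · intro hx
      choose H hH using hx
      refine ⟨H, ?_⟩
      rintro (f | i)
      · exact hH _ (.inl ⟨f, rfl⟩)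
      · exact hH _ (.inr ⟨i, rfl⟩)

-- This is the index of a composite. `Y` imposes the edge congruences alone and has index `∏
-- Mult(e)`. The map `δ` copies an edge entry to both flags; it satisfies `range δ + X = Y` and
-- pulls `X` back to the subgroup of `Φ`, because the two lattices at an edge meet in the edge
-- lattice. So [Y : X] = 𝔇_Γ.
omit [Fintype V] in
theorem index_edgeVector (hu : ∀ e b, T.dir e false ∈ T.sweepLattice A s e b)
    (hle : ∀ e b, T.edgeLattice e ≤ T.sweepLattice A s e b)
    (hinf : ∀ e n, (∀ b, n ∈ T.sweepLattice A s e b) → n ∈ T.edgeLattice e) :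
    (congrSubgroup T.edgeVector (T.flagLattice A s)).index =
      T.latticeMult A * ∏ e, T.edgeMult A s e (hu e) := by
  classical
  set X := congrSubgroup T.edgeVector (T.flagLattice A s) with hX
  let Z : E → AddSubgroup (Bool → N) := fun e => congrSubgroup (J := Bool) (fun _ => LinearMap.id)
    (fun b => T.sweepLattice A s e (!b))
  let ρ : E → ((E × Bool) ⊕ I → N) →+ (Bool → N) := fun e =>
    { toFun := fun x b => x (.inl (e, b)), map_zero' := rfl, map_add' := fun _ _ => rfl }
  let Y : AddSubgroup ((E × Bool) ⊕ I → N) := ⨅ e, (Z e).comap (ρ e)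
  have hYmem : ∀ x, x ∈ Y ↔ ∀ e, ρ e x ∈ Z e := fun x => by simp [Y, AddSubgroup.mem_iInf]
  have hY : Y.index = ∏ e, T.edgeMult A s e (hu e) := by
    simp_rw [edgeMult_eq_index]
    refine index_eq_prod_of_forall_mem ρ (fun y => ?_) _ _ hYmem
    exact ⟨Sum.elim (fun f => y f.1 f.2) 0, fun e => rfl⟩
  let δ : (E ⊕ I → N) →+ ((E × Bool) ⊕ I → N) :=
    { toFun := fun y => Sum.elim (fun f => y (.inl f.1)) fun i => y (.inr i)
      map_zero' := by ext (_ | _) <;> rfl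
      map_add' := fun _ _ => by ext (_ | _) <;> rfl }
  have hΦ : T.latticeMult A = (X.comap δ).index := by
    rw [latticeMult_eq_index]
    congr 1
    ext y
    refine exists_congr fun H => ?_
    rw [Sum.forall, Sum.forall]
    refine and_congr ⟨fun h f => hle _ _ (h f.1), fun h e => hinf e _ fun b => ?_⟩ Iff.rfl
    have := h (e, !b)
    change y (.inl e) - (H (T.bdry e true) - H (T.bdry e false)) ∈
      T.sweepLattice A s e (!!b) at this
    rwa [Bool.not_not] at this
  have hXY : X ≤ Y := by
    rintro x ⟨H, hH⟩
    rw [hYmem]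
    exact fun e => ⟨H (T.bdry e true) - H (T.bdry e false), fun b => hH (.inl (e, b))⟩
  have hsup : δ.range ⊔ X = Y := by
    apply le_antisymm
    · refine sup_le ?_ hXY
      rintro _ ⟨y, rfl⟩
      rw [hYmem]
      exact fun e => ⟨y (.inl e), fun b => by simp [ρ, δ]⟩
    · intro x hx
      rw [hYmem] at hx
      choose n hn using hx
      -- Subtracting a common representative `n e` from both flags of each edge leaves entries in
      -- the lattices, hence an element of `X` with `H = 0`.
      refine AddSubgroup.mem_sup.2 ⟨δ (Sum.elim n fun i => x (.inr i)), ⟨_, rfl⟩,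
        x - δ (Sum.elim n fun i => x (.inr i)), ⟨0, ?_⟩, by abel⟩
      rintro (f | i)
      · have := hn f.1 f.2
        simpa [δ, ρ, flagLattice] using this
      · simp [δ]
  rw [hΦ, AddSubgroup.index_comap, ← hY, ← AddSubgroup.relIndex_sup_right, hsup,
    AddSubgroup.relIndex_mul_index hXY]

/-- Only the position of the far end separates the edge vector at a flag from ± the position. It
lies in the lattice of the far side by the congruences there, in whichever mixture of the two kinds
they occur. -/
theorem EdgesSeparate.change_coordinates (hT : T.EdgesSeparate) (hconn : T.IsConnected)
    (hneg : ∀ e b, T.dir e (!b) = -T.dir e b) (hh : h ∈ T.moduli A s) :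
    (congrSubgroup T.position (T.flagLattice A s)).index =
      (congrSubgroup T.edgeVector (T.flagLattice A s)).index ∧
    ∀ H, (∀ j, T.position j H ∈ T.flagLattice A s j) ↔
      (∀ j, T.edgeVector j H ∈ T.flagLattice A s j) := by
  classical
  -- The edge vector is (end `true`) − (end `false`), which fixes the signs.
  refine congrSubgroup_change_all _ _ _ (Sum.elim (fun f => if f.2 then 1 else -1) fun _ => 1) ?_
  rintro S (⟨e, b⟩ | i) - H hH
  · have key : H (T.bdry e !b) ∈ T.sweepLattice A s e (!b) := by
      refine hT.apply_bdry_mem_sweepLattice_of_side hconn hneg hh H e (!b)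
        (fun e' c he' _ => ?_) fun i _ => ?_
      · have := hH (.inl (e', c)) (by simp [he'])
        split_ifs at this
        · exact Or.inr this
        · exact Or.inl this
      · have := hH (.inr i) (by simp)
        split_ifs at this <;> exact this
    cases b
    · simpa [flagLattice, position, edgeVector] using key
    · simpa [flagLattice, position, edgeVector] using key
  · simp [position, edgeVector]

-- Putting `x true − x false` in the entry at `e` of the target of `Φ` and 0 elsewhere maps `N²` to
-- that target. The preimage of the finite-index subgroup of `Φ` is contained in the edge subgroup.
omit [Fintype V] in
open Classical in
theorem EdgesSeparate.edgeMult_ne_zero (hT : T.EdgesSeparate)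
    (hneg : ∀ e b, T.dir e (!b) = -T.dir e b) (hh : h ∈ T.moduli A s)
    (hΦ : T.latticeMult A ≠ 0) (e : E)
    (hu : ∀ b, T.dir e false ∈ T.sweepLattice A s e b) : T.edgeMult A s e hu ≠ 0 := by
  have hle := hT.edgeLattice_le_sweepLattice hneg hh
  rw [edgeMult_eq_index]
  rw [latticeMult_eq_index] at hΦ
  set X := congrSubgroup (A := V → N)
      (Sum.elim (fun e => LinearMap.proj (R := ℤ) (φ := fun _ => N) (T.bdry e true) -
        LinearMap.proj (T.bdry e false)) fun i => LinearMap.proj (T.leg i))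
      (Sum.elim T.edgeLattice fun i => latticePart (A i).direction)
  let g : (Bool → N) →+ (E ⊕ I → N) := (AddMonoidHom.single (fun _ => N) (.inl e)).comp
    (Pi.evalAddMonoidHom (fun _ => N) true - Pi.evalAddMonoidHom (fun _ => N) false)
  have hX : (X.comap g).index ≠ 0 := by
    rw [AddSubgroup.index_comap]
    exact fun h0 => hΦ (Nat.eq_zero_of_zero_dvd
      (h0 ▸ AddSubgroup.relIndex_dvd_index_of_normal X g.range))
  refine fun h0 => hX (Nat.eq_zero_of_zero_dvd (h0 ▸ AddSubgroup.index_dvd_of_le ?_))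
  rintro x ⟨H, hH⟩
  have hE : x true - x false - (H (T.bdry e true) - H (T.bdry e false)) ∈ T.edgeLattice e := by
    simpa [g] using hH (.inl e)
  have hside := hT.apply_bdry_mem_sweepLattice hneg hh (e := e) (H := H)
    (fun e' he' => by
      have := (T.edgeLattice e').neg_mem (hH (.inl e'))
      simpa [g, he'] using this)
    (fun i => by
      have := (latticePart (A i).direction).neg_mem (hH (.inr i))
      simpa [g] using this)
  -- The ends of `e` lie in the lattices of their own sides, so this element is `x false` modulo the
  -- side `true` and, up to an edge-lattice term, `x true` modulo the side `false`.
  refine ⟨x false + H (T.bdry e true), ?_⟩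
  rw [Bool.forall_bool]
  constructor
  · have := Submodule.neg_mem _ (hside true)
    simpa using this
  · have := Submodule.sub_mem _ (hle e false hE) (hside false)
    have heq : x true - (x false + H (T.bdry e true)) =
        x true - x false - (H (T.bdry e true) - H (T.bdry e false)) - H (T.bdry e false) := by
      abel
    change x true - (x false + H (T.bdry e true)) ∈ T.sweepLattice A s e false
    rwa [heq]

end Formula

end CurveType
end Tropical

/-! ### Injectivity of the edge and vertex maps -/

namespace Tropical
namespace CurveType

variable {N V E I : Type*} [AddCommGroup N] [Fintype I] {T : CurveType N V E I}
  {A : I → AffineSubspace ℝ (RealSpace N)} {s : I → ℕ}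

theorem edgeMap_injective {e : E} (hu : ∀ b, T.dir e false ∈ T.sweepLattice A s e b)
    (hinf : ∀ n, (∀ b, n ∈ T.sweepLattice A s e b) → n ∈ Submodule.span ℤ {T.dir e false}) :
    Function.Injective (T.edgeMap A s e hu) := by
  rw [injective_iff_map_eq_zero]
  intro x hx
  obtain ⟨n, rfl⟩ := Submodule.mkQ_surjective _ x
  have h1 : (T.sweepLattice A s e true).mkQ n = 0 := congrArg Prod.fst hx
  have h2 : (T.sweepLattice A s e false).mkQ n = 0 := congrArg Prod.snd hx
  rw [Submodule.mkQ_apply, Submodule.Quotient.mk_eq_zero] at h1 h2 ⊢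
  exact hinf n (Bool.forall_bool.2 ⟨h2, h1⟩)

/-- Put a kernel element at `v` and 0 at all other vertices: the position congruences hold, hence so
do those on edge vectors, and `Φ` kills it. -/
theorem vertexMap_injective (hΦ : Function.Injective (T.Phi A))
    (hinf : ∀ e n, (∀ b, n ∈ T.sweepLattice A s e b) → n ∈ T.edgeLattice e)
    (hker : ∀ H, (∀ j, T.position j H ∈ T.flagLattice A s j) ↔
      (∀ j, T.edgeVector j H ∈ T.flagLattice A s j)) (v : V) :
    Function.Injective (T.vertexMap A s v) := by
  classical
  rw [injective_iff_map_eq_zero]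
  intro n hn
  have hflag : ∀ f : {f : E × Bool // T.bdry f.1 f.2 = v},
      n ∈ T.sweepLattice A s f.1.1 (!f.1.2) := fun f =>
    (Submodule.Quotient.mk_eq_zero _).1 (congrFun (congrArg Prod.fst hn) f)
  have hleg : ∀ i : {i // T.leg i = v}, n ∈ latticePart (A i.1).direction := fun i =>
    (Submodule.Quotient.mk_eq_zero _).1 (congrFun (congrArg Prod.snd hn) i)
  have hpos : ∀ j, T.position j (Pi.single v n) ∈ T.flagLattice A s j := by
    rintro (f | i)
    · by_cases hf : T.bdry f.1 f.2 = v
      · simpa [position, flagLattice, hf] using hflag ⟨f, hf⟩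
      · simp [position, flagLattice, Pi.single_eq_of_ne hf]
    · by_cases hi : T.leg i = v
      · simpa [position, flagLattice, hi] using hleg ⟨i, hi⟩
      · simp [position, flagLattice, Pi.single_eq_of_ne hi]
  have hedge := (hker _).1 hpos
  have hzero : T.Phi A (Pi.single v n) = 0 := by
    refine Prod.ext (funext fun e => ?_) (funext fun i => ?_)
    · refine (Submodule.Quotient.mk_eq_zero _).2 (hinf e _ fun b => ?_)
      have := hedge (.inl (e, !b))
      change _ ∈ T.sweepLattice A s e (!!b) at this
      rwa [Bool.not_not] at this
    · exact (Submodule.Quotient.mk_eq_zero _).2 (hedge (.inr i))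
  have := congrFun (hΦ (hzero.trans (map_zero _).symm)) v
  simpa using this

end CurveType
end Tropical

end

/-- Let `T` be the type of a tropical curve of genus `0` in `N_ℝ`, with rational linear spaces
`L i` (the directions of the constraints) and `ψ`-class conditions `s`.
(1) For generic translates of the `L i`, every non-superabundant tropical curve of type `T` which
satisfies the conditions, where these have complementary codimension, is rigid.
(2) For every rigid tropical curve (with respect to any translates of the `L i`), all the lattice
maps involved are well-defined inclusions of finite index, and the multiplicity formulas hold. -/
theorem mainTheorem3 {N V E I : Type*} [AddCommGroup N] [Module.Free ℤ N] [Module.Finite ℤ N]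
    [Fintype V] [Fintype E] [Fintype I]
    (T : Tropical.CurveType N V E I) (hT : T.IsTropical) (hgenus : T.totalGenus = 0)
    (L : I → Submodule ℝ (Tropical.RealSpace N)) (hL : ∀ i, Tropical.IsRational (L i))
    (s : I → ℕ) :
    (∃ F : Set (AffineSubspace ℝ (I → Tropical.RealSpace N)), F.Finite ∧ (∀ B ∈ F, B ≠ ⊤) ∧
      ∀ a : I → Tropical.RealSpace N, (∀ B ∈ F, a ∉ B) →
        ∀ h ∈ T.moduli (fun i => AffineSubspace.mk' (a i) (L i)) s,
          T.IsNonSuperabundant →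
          T.HasComplementaryCodim (fun i => AffineSubspace.mk' (a i) (L i)) →
          T.IsRigid (fun i => AffineSubspace.mk' (a i) (L i)) s h) ∧
    (∀ A : I → AffineSubspace ℝ (Tropical.RealSpace N), (∀ i, (A i).direction = L i) →
      ∀ h, T.IsRigid A s h →
        Function.Injective (T.Phi A) ∧ T.latticeMult A ≠ 0 ∧
        (∀ v, Function.Injective (T.vertexMap A s v) ∧ T.vertexMult A s v ≠ 0) ∧
        ∃ hu : ∀ e b, T.dir e false ∈ T.sweepLattice A s e b,
          (∀ e, Function.Injective (T.edgeMap A s e (hu e)) ∧ T.edgeMult A s e (hu e) ≠ 0) ∧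
          (T.latticeMult A : ℚ) =
            (∏ v, (T.vertexMult A s v : ℚ)) / ∏ e, (T.edgeMult A s e (hu e) : ℚ) ∧
          (T.mult A : ℚ) =
            (∏ v, (T.vertexMult A s v : ℚ)) *
              ∏ e, ((T.weight e : ℚ) / (T.edgeMult A s e (hu e) : ℚ))) := by
  refine ⟨Tropical.CurveType.exists_finite_forall_isRigid L s, ?_⟩
  intro A hA h hh
  have hconn := hT.connected
  have h0 := hh.nonSuperabundant.2.1
  have hne : T.cell.Nonempty := ⟨h, hh.mem.1⟩
  have hsep : T.EdgesSeparate := Tropical.CurveType.edgesSeparate_of_card hconn (by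
    have := Tropical.CurveType.card_add_one_eq_of_totalGenus_eq_zero hgenus h0
    omega)
  have htan := hh.tangent_eq_bot
  have hdir := hh.nonSuperabundant.dir_ne_zero hne hgenus hconn
  -- No compact edge is contracted, so all weights are positive and the directions primitive.
  have hedge : ∀ e, T.edgeLattice e = Submodule.span ℤ {T.dir e false} := fun e =>
    Tropical.latticePart_span_singleton (hT.dir_primitive e false
      (Nat.pos_of_ne_zero fun hw => hdir e (hT.dir_zero e false hw)))
  have hrat : ∀ i, Tropical.IsRational (A i).direction := fun i => by rw [hA i]; exact hL i
  have hΦ := Tropical.CurveType.latticeMult_ne_zero hrat htan hgenus h0 hh.codim hdir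
  have hinj := Tropical.CurveType.phi_injective htan
  have hle := hsep.edgeLattice_le_sweepLattice hT.dir_neg hh.mem
  have hinf : ∀ e n, (∀ b, n ∈ T.sweepLattice A s e b) → n ∈ T.edgeLattice e := fun e n =>
    hsep.mem_edgeLattice_of_mem_sweepLattice hconn hT.dir_neg hh.mem htan
  have hu : ∀ e b, T.dir e false ∈ T.sweepLattice A s e b := fun e b =>
    hle e b (by rw [hedge]; exact Submodule.mem_span_singleton_self _)
  have hedgeMult : ∀ e, T.edgeMult A s e (hu e) ≠ 0 := fun e =>
    hsep.edgeMult_ne_zero hT.dir_neg hh.mem hΦ e (hu e)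
  obtain ⟨hindex, hker⟩ := hsep.change_coordinates hconn hT.dir_neg hh.mem
  rw [← Tropical.CurveType.prod_vertexMult_eq_index,
    Tropical.CurveType.index_edgeVector hu hle hinf] at hindex
  have hformula : (T.latticeMult A : ℚ) =
      (∏ v, (T.vertexMult A s v : ℚ)) / ∏ e, (T.edgeMult A s e (hu e) : ℚ) := by
    rw [eq_div_iff (Finset.prod_ne_zero_iff.2 fun e _ => Nat.cast_ne_zero.2 (hedgeMult e))]
    exact_mod_cast hindex.symm
  refine ⟨hinj, hΦ, fun v => ⟨?_, ?_⟩, hu, fun e => ⟨?_, hedgeMult e⟩, hformula, ?_⟩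
  · exact Tropical.CurveType.vertexMap_injective hinj hinf hker v
  -- Finiteness at the vertices is read off from the product formula, which holds with index 0
  -- standing for infinity.
  · have hprod : ∏ v, T.vertexMult A s v ≠ 0 := by
      rw [hindex]
      exact mul_ne_zero hΦ (Finset.prod_ne_zero_iff.2 fun e _ => hedgeMult e)
    exact Finset.prod_ne_zero_iff.1 hprod v (Finset.mem_univ v)
  · exact Tropical.CurveType.edgeMap_injective (hu e) fun n hn => hedge e ▸ hinf e n hn
  · rw [Tropical.CurveType.mult, Nat.cast_mul, hformula, Nat.cast_prod, Finset.prod_div_distrib,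
      div_mul_eq_mul_div, mul_div_assoc]
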